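/- All manifolds are smooth, finite-dimensional, Hausdorff, paracompact and without boundary. Let $G$ be a connected, non-simply-connected Lie group, and let $\rho:\tilde G\to G$ be its universal covering group, i.e. $\tilde G$ is a simply connected Lie group and $\rho$ is a homomorphism which is a smooth covering map. Let $\pi_P:P\to M$ be a smooth (right) principal $G$-bundle over a connected manifold $M$, and fix $p_0\in P$. Write $\pi_1(P)=\pi_1(P,p_0)$, $\pi_1(M)=\pi_1(M,\pi_P(p_0))$, $\pi_1(G)=\pi_1(G,e)$, let $\pi_{P*}:\pi_1(P)\to\pi_1(M)$ be the homomorphism induced by $\pi_P$, and let $i_*:\pi_1(G)\to\pi_1(P)$ be the homomorphism induced by $i:G\to P$, $i(g)=p_0g$. A spinor structure for $P$ is a smooth principal $\tilde G$-bundle $\pi_Q:Q\to M$ together with a smooth map $u:Q\to P$ such that $\pi_P\circ u=\pi_Q$ and $u(q\tilde g)=u(q)\rho(\tilde g)$ for all $q\in Q$, $\tilde g\in\tilde G$. Then $P$ has a spinor structure if and only if there are subgroups $K$ and $I$ of $\pi_1(P)$ such that $\pi_1(P)$ is the internal direct product $K\times I$ (the elements of $K$ commute with those of $I$, $K\cap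 I$ is trivial, and $K$ and $I$ together generate $\pi_1(P)$), $\pi_{P*}$ maps $K$ isomorphically onto $\pi_1(M)$, and $i_*$ maps $\pi_1(G)$ isomorphically onto $I$. -/

import Mathlib

open scoped Manifold ContDiff

universe uM uG uGt uP

/-- A smooth principal fibre bundle `π : P → M` with structure group `G`, where `M`, `G`, `P` are
smooth manifolds of dimension `n`, `k`, `d`. The right action `p g` of `G` on `P` is the action
`MulOpposite.op g • p` of the opposite group. -/
structure IsPrincipalBundle (n k d : ℕ)
    {M : Type uM} [TopologicalSpace M] [ChartedSpace (EuclideanSpace ℝ (Fin n)) M]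
    (G : Type uG) [Group G] [TopologicalSpace G] [ChartedSpace (EuclideanSpace ℝ (Fin k)) G]
    {P : Type uP} [TopologicalSpace P] [ChartedSpace (EuclideanSpace ℝ (Fin d)) P]
    [MulAction Gᵐᵒᵖ P] (π : P → M) : Prop where
  smooth_proj : ContMDiff (𝓡 d) (𝓡 n) ∞ π
  surjective_proj : Function.Surjective π
  smooth_action :
    ContMDiff ((𝓡 d).prod (𝓡 k)) (𝓡 d) ∞ (fun x : P × G => MulOpposite.op x.2 • x.1)
  proj_action : ∀ (p : P) (g : G), π (MulOpposite.op g • p) = π p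
  transitive : ∀ p p' : P, π p = π p' → ∃ g : G, MulOpposite.op g • p = p'
  free : ∀ (p : P) (g : G), MulOpposite.op g • p = p → g = 1
  /-- Around each point of the base there is a trivialisation `φ : U × G → π⁻¹(U)` (the inverse of
  `e` below), which is a diffeomorphism and satisfies `φ (m, g) = φ (m, 1) g`. -/
  locally_trivial : ∀ m₀ : M, ∃ e : Bundle.Trivialization G π, m₀ ∈ e.baseSet ∧
    ContMDiffOn (𝓡 d) ((𝓡 n).prod (𝓡 k)) ∞ e.toOpenPartialHomeomorph e.source ∧
    ContMDiffOn ((𝓡 n).prod (𝓡 k)) (𝓡 d) ∞ e.toOpenPartialHomeomorph.symm e.target ∧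
    ∀ m ∈ e.baseSet, ∀ g : G, e.toOpenPartialHomeomorph.symm (m, g) =
      MulOpposite.op g • e.toOpenPartialHomeomorph.symm (m, (1 : G))

/-- `ρ : G̃ → G` makes the Lie group `G̃` a universal covering group of the Lie group `G`:
`G̃` is simply connected and `ρ` is a homomorphism and a smooth covering map. -/
structure IsUniversalCoveringGroup (k : ℕ)
    {G : Type uG} [Group G] [TopologicalSpace G] [ChartedSpace (EuclideanSpace ℝ (Fin k)) G]
    {G' : Type uGt} [Group G'] [TopologicalSpace G'] [ChartedSpace (EuclideanSpace ℝ (Fin k)) G']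
    (ρ : G' →* G) : Prop where
  simplyConnected : SimplyConnectedSpace G'
  isCoveringMap : IsCoveringMap ρ
  isLocalDiffeomorph : IsLocalDiffeomorph (𝓡 k) (𝓡 k) ∞ ρ

/-- A spinor structure for the bundle `πP : P → M` relative to `ρ : G' → G`: a principal
`G'`-bundle `πQ : Q → M` together with a smooth map `u : Q → P` over the identity of `M` such that
`u (q g̃) = u q (ρ g̃)`. -/
structure SpinorStructure (n k d : ℕ)
    {M : Type uM} [TopologicalSpace M] [ChartedSpace (EuclideanSpace ℝ (Fin n)) M]
    {G : Type uG} [Group G]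
    {G' : Type uGt} [Group G'] [TopologicalSpace G'] [ChartedSpace (EuclideanSpace ℝ (Fin k)) G']
    (ρ : G' →* G)
    {P : Type uP} [TopologicalSpace P] [ChartedSpace (EuclideanSpace ℝ (Fin d)) P]
    [MulAction Gᵐᵒᵖ P] (πP : P → M) where
  /-- The total space, a smooth manifold of dimension `dim`. -/
  Q : Type uP
  dim : ℕ
  [topologicalSpace : TopologicalSpace Q]
  [chartedSpace : ChartedSpace (EuclideanSpace ℝ (Fin dim)) Q]
  [isManifold : IsManifold (𝓡 dim) ∞ Q]
  [t2Space : T2Space Q]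
  [paracompactSpace : ParacompactSpace Q]
  [mulAction : MulAction G'ᵐᵒᵖ Q]
  πQ : Q → M
  isPrincipalBundle : IsPrincipalBundle n k dim G' πQ
  /-- The spinor map. -/
  u : Q → P
  smooth_u : ContMDiff (𝓡 dim) (𝓡 d) ∞ u
  proj_u : ∀ q : Q, πP (u q) = πQ q
  equivariant_u : ∀ (q : Q) (g : G'),
    u (MulOpposite.op g • q) = MulOpposite.op (ρ g) • u q

/-- The group `Γ` is the internal direct product of its subgroups `K` and `L`. -/
structure IsInternalDirectProduct {Γ : Type*} [Group Γ] (K L : Subgroup Γ) : Prop where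
  commute : ∀ x ∈ K, ∀ y ∈ L, x * y = y * x
  inf_eq_bot : K ⊓ L = ⊥
  sup_eq_top : K ⊔ L = ⊤

namespace IsPrincipalBundle

variable {n k d : ℕ}
  {M : Type uM} [TopologicalSpace M] [ChartedSpace (EuclideanSpace ℝ (Fin n)) M]
  {G : Type uG} [Group G] [TopologicalSpace G] [ChartedSpace (EuclideanSpace ℝ (Fin k)) G]
  {P : Type uP} [TopologicalSpace P] [ChartedSpace (EuclideanSpace ℝ (Fin d)) P]
  [MulAction Gᵐᵒᵖ P] {π : P → M}

/-- The projection as a continuous map. -/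
def projMap (h : IsPrincipalBundle n k d G π) : C(P, M) :=
  ⟨π, h.smooth_proj.continuous⟩

/-- The map `i : G → P`, `i g = p₀ g`. -/
def orbitMap (h : IsPrincipalBundle n k d G π) (p₀ : P) : C(G, P) :=
  ⟨fun g => MulOpposite.op g • p₀,
    h.smooth_action.continuous.comp (Continuous.prodMk_right p₀)⟩

theorem orbitMap_one (h : IsPrincipalBundle n k d G π) (p₀ : P) : h.orbitMap p₀ 1 = p₀ :=
  one_smul Gᵐᵒᵖ p₀

/-- The homomorphism `π₁(P, p₀) → π₁(M, π p₀)` induced by the projection. -/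
noncomputable def projPi1 (h : IsPrincipalBundle n k d G π) (p₀ : P) :
    FundamentalGroup P p₀ →* FundamentalGroup M (π p₀) :=
  FundamentalGroup.map h.projMap p₀

/-- The homomorphism `i_* : π₁(G, 1) → π₁(P, p₀)` induced by `g ↦ p₀ g`. -/
noncomputable def orbitPi1 (h : IsPrincipalBundle n k d G π) (p₀ : P) :
    FundamentalGroup G (1 : G) →* FundamentalGroup P p₀ :=
  FundamentalGroup.mapOfEq (h.orbitMap p₀) (h.orbitMap_one p₀)

end IsPrincipalBundle

/-! A spinor map u : Q → P is the quotient by the discrete group ker ρ, hence a covering. The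
question is therefore which coverings of P carry a G̃-action making them principal over M, and
coverings are read through the monodromy action of π₁(P) on the fibre over p₀. The bridge is
`monodromy_orbitPi1`: the loop i ∘ l moves q to q·L(1), where L is the lift of l to G̃ starting at
1. Since G̃ is simply connected, taking endpoints of lifts identifies π₁(G) with ker ρ
(`eq_one_of_monodromy_eq_one`, `exists_monodromy_eq`).

Given a spinor structure, ker ρ acts simply transitively on the fibre of u over p₀. So i_* is
injective, and its image I is a complement of the stabiliser K of a point of that fibre. Moreover I
is central (`orbitPi1_comm`) and is the kernel of the surjection π_{P*} (`mem_range_orbitPi1`,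
`projPi1_orbitPi1`, `surjective_projPi1`), so K maps isomorphically onto π₁(M).

Conversely, K determines a covering of P with fibre π₁(P)/K and monodromy given by left translation.
The action of G̃ on P through ρ lifts to it (`exists_lift_action`). On the fibre, ker ρ acts as I
does, hence simply transitively because I is a complement of K. Thus G̃ acts simply transitively on
the fibres over M, and the smooth structure pulled back from P gives a principal bundle.

One construction, `exists_isCoveringMap_monodromy`, supplies both this covering and exactness at
π₁(P): a class killed by π_{P*} has trivial monodromy in the covering of M attached to π₁(P) →
π₁(P)/I, so it lies in I. -/

/-! ### Topology of manifolds: σ-compactness and simply connected neighbourhoods. -/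

section Topology

open Set Topology Filter

/-- A connected, paracompact, locally compact Hausdorff space is `σ`-compact. -/
theorem sigmaCompactSpace_of_paracompact_connected (X : Type*) [TopologicalSpace X]
    [T2Space X] [LocallyCompactSpace X] [ParacompactSpace X] [ConnectedSpace X] :
    SigmaCompactSpace X := by
  classical
  have hK : ∀ x : X, ∃ K : Set X, IsCompact K ∧ K ∈ 𝓝 x := fun x => exists_compact_mem_nhds x
  choose K hKc hKn using hK
  obtain ⟨V, hVo, hVc, hVlf, hVs⟩ := precise_refinement (fun x => interior (K x))
    (fun x => isOpen_interior)
    (eq_univ_of_forall fun x => mem_iUnion.2 ⟨x, mem_interior_iff_mem_nhds.2 (hKn x)⟩)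
  have hVK : ∀ x, IsCompact (closure (V x)) := fun x =>
    (hKc x).of_isClosed_subset isClosed_closure
      (closure_minimal ((hVs x).trans interior_subset) (hKc x).isClosed)
  -- By local finiteness only finitely many `V i` meet a compact set, so `step` preserves
  -- compactness. The union of its iterates from a point is clopen.
  let step : Set X → Set X := fun C => ⋃ i ∈ {i | (V i ∩ C).Nonempty}, closure (V i)
  have hstep : ∀ C, IsCompact C → IsCompact (step C) := fun C hC =>
    (hVlf.finite_nonempty_inter_compact hC).isCompact_biUnion fun i _ => hVK i
  have hmem : ∀ C i, (V i ∩ C).Nonempty → V i ⊆ step C := fun C i h =>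
    subset_closure.trans (subset_biUnion_of_mem (u := fun i => closure (V i)) h)
  obtain ⟨x₀⟩ := (inferInstance : Nonempty X)
  let C : ℕ → Set X := fun m => step^[m] {x₀}
  have hCs : ∀ m, C (m + 1) = step (C m) := fun m => Function.iterate_succ_apply' ..
  have hCc : ∀ m, IsCompact (C m) := by
    intro m
    induction m with
    | zero => exact isCompact_singleton
    | succ m ih => rw [hCs]; exact hstep _ ih
  have hcov : ∀ x, ∃ i, x ∈ V i := fun x => mem_iUnion.1 (hVc ▸ mem_univ x)
  have huniv : ⋃ m, C m = univ := by
    refine IsClopen.eq_univ ⟨?_, ?_⟩ ⟨x₀, mem_iUnion.2 ⟨0, rfl⟩⟩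
    · refine isClosed_of_closure_subset fun x hx => ?_
      obtain ⟨i, hi⟩ := hcov x
      obtain ⟨y, hyV, hy⟩ := mem_closure_iff.1 hx (V i) (hVo i) hi
      obtain ⟨m, hm⟩ := mem_iUnion.1 hy
      exact mem_iUnion.2 ⟨m + 1, by rw [hCs]; exact hmem _ i ⟨y, hyV, hm⟩ hi⟩
    · refine isOpen_iff_mem_nhds.2 fun x hx => ?_
      obtain ⟨m, hm⟩ := mem_iUnion.1 hx
      obtain ⟨i, hi⟩ := hcov x
      refine mem_of_superset ((hVo i).mem_nhds hi) ?_
      refine Subset.trans ?_ (subset_iUnion C (m + 1))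
      rw [hCs]; exact hmem _ i ⟨x, hi, hm⟩
  exact ⟨⟨C, hCc, huniv⟩⟩

/-- Points of a space locally modelled on a normed space have arbitrarily small simply connected
open neighbourhoods. -/
theorem exists_isSimplyConnected_nhds {E : Type*} [NormedAddCommGroup E] [NormedSpace ℝ E]
    {X : Type*} [TopologicalSpace X] [ChartedSpace E X] (x : X) {U : Set X} (hU : U ∈ 𝓝 x) :
    ∃ V ⊆ U, IsOpen V ∧ x ∈ V ∧ IsSimplyConnected V := by
  let e := chartAt E x
  have hx : x ∈ e.source := mem_chart_source E x
  have h1 : e.symm ⁻¹' U ∈ 𝓝 (e x) :=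
    (e.continuousAt_symm (e.map_source hx)).preimage_mem_nhds (by rwa [e.left_inv hx])
  obtain ⟨r, hr, hball⟩ := Metric.mem_nhds_iff.1
    (inter_mem h1 (e.open_target.mem_nhds (e.map_source hx)))
  let e' := e.symm.restrOpen (Metric.ball (e x) r) Metric.isOpen_ball
  have hsrc : e'.source = Metric.ball (e x) r := by
    simp only [e', OpenPartialHomeomorph.restrOpen_source, OpenPartialHomeomorph.symm_source]
    exact inter_eq_right.2 fun z hz => (hball hz).2
  refine ⟨e'.target, ?_, e'.open_target, ?_, ?_⟩
  · intro z hz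
    have := e'.map_target hz
    rw [hsrc] at this
    have h2 := (hball this).1
    rw [mem_preimage] at h2
    have h3 : e' (e'.symm z) = z := e'.right_inv hz
    exact h3 ▸ h2
  · have : e' (e x) = x := e.left_inv hx
    rw [← this]
    exact e'.map_source (by rw [hsrc]; exact Metric.mem_ball_self hr)
  · have : ContractibleSpace e'.source := by
      rw [hsrc]
      exact (convex_ball (e x) r).contractibleSpace ⟨_, Metric.mem_ball_self hr⟩
    exact e'.toHomeomorphSourceTarget.symm.toHomotopyEquiv.simplyConnectedSpace

end Topology

/-! ### Smooth structure pulled back along a local homeomorphism. -/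

section LocalHomeomorph

open Set Topology Filter

variable {d : ℕ} {Q P : Type*} [TopologicalSpace Q] [TopologicalSpace P]
  [ChartedSpace (EuclideanSpace ℝ (Fin d)) P] {u : Q → P}

/-- The charted space structure pulled back along a local homeomorphism. -/
noncomputable abbrev IsLocalHomeomorph.pullbackChartedSpace (hu : IsLocalHomeomorph u) :
    ChartedSpace (EuclideanSpace ℝ (Fin d)) Q where
  atlas := {c | ∃ q, c = (hu q).choose.trans (chartAt (EuclideanSpace ℝ (Fin d)) (u q))}
  chartAt q := (hu q).choose.trans (chartAt (EuclideanSpace ℝ (Fin d)) (u q))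
  mem_chart_source q := by
    have h := (hu q).choose_spec
    simp only [OpenPartialHomeomorph.trans_source, mem_inter_iff, mem_preimage]
    exact ⟨h.1, by rw [← h.2]; exact mem_chart_source _ _⟩
  chart_mem_atlas q := ⟨q, rfl⟩

/-- All local branches are restrictions of the same map `u`, so they cancel in a transition map,
leaving a restriction of a transition map of `P`. -/
theorem IsLocalHomeomorph.isManifold_pullback [IsManifold (𝓡 d) ∞ P] (hu : IsLocalHomeomorph u) :
    letI := hu.pullbackChartedSpace (d := d)
    IsManifold (𝓡 d) ∞ Q := by
  let := hu.pullbackChartedSpace (d := d)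
  refine isManifold_of_contDiffOn _ _ _ ?_
  rintro _ _ ⟨q, rfl⟩ ⟨q', rfl⟩
  have h := (hu q).choose_spec
  have h' := (hu q').choose_spec
  set f := (hu q).choose
  set f' := (hu q').choose
  set c := chartAt (EuclideanSpace ℝ (Fin d)) (u q)
  set c' := chartAt (EuclideanSpace ℝ (Fin d)) (u q')
  have hff' : (f' : Q → P) = f := h'.2.symm.trans h.2
  have key := (mem_groupoid_of_pregroupoid.1 (HasGroupoid.compatible
    (G := contDiffGroupoid ∞ (𝓡 d)) (chart_mem_atlas (EuclideanSpace ℝ (Fin d)) (u q))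
    (chart_mem_atlas (EuclideanSpace ℝ (Fin d)) (u q')))).1
  refine (key.mono ?_).congr ?_
  · intro z hz
    simp only [mfld_simps] at hz ⊢
    simp only [hff'] at hz
    rw [f.right_inv hz.1.2] at hz
    exact ⟨hz.1.1, hz.2.2⟩
  · intro z hz
    simp only [mfld_simps] at hz ⊢
    simp only [hff']
    rw [f.right_inv hz.1.2]

/-- A chart of `Q` is a chart of `P` composed with `u`, so both sides have the same coordinate
expression. Continuity must be required separately, as `u ∘ f` does not control the sheet. -/
theorem IsLocalHomeomorph.contMDiffAt_pullback_iff (hu : IsLocalHomeomorph u)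
    {E H N : Type*} [NormedAddCommGroup E] [NormedSpace ℝ E] [TopologicalSpace H]
    {I : ModelWithCorners ℝ E H} [TopologicalSpace N] [ChartedSpace H N] {f : N → Q} {x : N} :
    letI := hu.pullbackChartedSpace (d := d)
    ContMDiffAt I (𝓡 d) ∞ f x ↔ ContinuousAt f x ∧ ContMDiffAt I (𝓡 d) ∞ (u ∘ f) x := by
  let := hu.pullbackChartedSpace (d := d)
  have h := (hu (f x)).choose_spec
  have e1 : (extChartAt (𝓡 d) (f x) : Q → _) = extChartAt (𝓡 d) (u (f x)) ∘ u := by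
    have : (extChartAt (𝓡 d) (f x) : Q → _) =
      extChartAt (𝓡 d) (u (f x)) ∘ (hu (f x)).choose := rfl
    rw [this, ← h.2]
  rw [_root_.contMDiffAt_iff, _root_.contMDiffAt_iff, e1]
  constructor
  · rintro ⟨h1, h2⟩
    exact ⟨h1, hu.continuous.continuousAt.comp h1, h2⟩
  · rintro ⟨h1, -, h2⟩
    exact ⟨h1, h2⟩

theorem IsLocalHomeomorph.contMDiff_pullback (hu : IsLocalHomeomorph u) :
    letI := hu.pullbackChartedSpace (d := d)
    ContMDiff (𝓡 d) (𝓡 d) ∞ u := by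
  let := hu.pullbackChartedSpace (d := d)
  exact fun q => (hu.contMDiffAt_pullback_iff.1 (contMDiffAt_id (I := 𝓡 d) (x := q))).2

end LocalHomeomorph

/-! ### Coverings with prescribed monodromy. -/

section CoveringOfHom

open Set Topology Filter unitInterval

/-- A homotopy invariant, multiplicative assignment of elements of a group to paths. -/
structure PathTransport (Y A : Type*) [TopologicalSpace Y] [Group A] where
  val : ∀ {x y : Y}, Path x y → A
  val_trans : ∀ {x y z : Y} (p : Path x y) (q : Path y z), val (p.trans q) = val p * val q
  val_eq_of_homotopic : ∀ {x y : Y} {p q : Path x y}, p.Homotopic q → val p = val q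

namespace PathTransport

variable {Y A : Type*} [TopologicalSpace Y] [Group A] (F : PathTransport Y A)

theorem val_refl (y : Y) : F.val (Path.refl y) = 1 := by
  have h := F.val_trans (Path.refl y) (Path.refl y)
  rw [Path.refl_trans_refl] at h
  exact left_eq_mul.1 h

theorem val_symm {x y : Y} (p : Path x y) : F.val p.symm = (F.val p)⁻¹ := by
  rw [eq_inv_iff_mul_eq_one, ← F.val_trans, F.val_eq_of_homotopic (Path.Homotopic.symm_trans p),
    F.val_refl]

theorem val_cast {x y x' y' : Y} (p : Path x y) (hx : x' = x) (hy : y' = y) :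
    F.val (p.cast hx hy) = F.val p := by
  subst hx hy; rfl

theorem val_subpath {x y : Y} (p : Path x y) (r s t : I) :
    F.val (p.subpath r s) * F.val (p.subpath s t) = F.val (p.subpath r t) := by
  rw [← F.val_trans]
  exact F.val_eq_of_homotopic ⟨Path.Homotopy.subpathTransSubpath p r s t⟩

open FundamentalGroup in
/-- The transport determined by a homomorphism on the fundamental group and a choice of paths from
the base point. -/
noncomputable def ofHom {y₀ : Y} (φ : FundamentalGroup Y y₀ →* A) (γ : ∀ y, Path y₀ y) :
    PathTransport Y A where
  -- Multiplication in `FundamentalGroup` is reverse concatenation; the inverse makes `val`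
  -- multiplicative along concatenation.
  val {x y} p := (φ (fromPath (.mk ((γ x).trans (p.trans (γ y).symm)))))⁻¹
  val_trans {x y z} p q := by
    rw [← mul_inv_rev, ← map_mul]
    congr 2
    rw [mul_def]
    simp only [Path.Homotopic.Quotient.mk_trans, Path.Homotopic.Quotient.mk_symm]
    simp only [Path.Homotopic.Quotient.trans_assoc]
    congr 2
    rw [← Path.Homotopic.Quotient.trans_assoc _ (Path.Homotopic.Quotient.mk (γ y)),
      Path.Homotopic.Quotient.symm_trans, Path.Homotopic.Quotient.refl_trans]
  val_eq_of_homotopic {x y p q} h := by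
    simp only [Path.Homotopic.Quotient.mk_trans, Path.Homotopic.Quotient.eq.2 h]

end PathTransport

/-- A transport on the total space of `f : Y → X` which is locally trivial over `X`. -/
structure LocallyTrivialTransport (Y X A : Type*) [TopologicalSpace Y] [TopologicalSpace X]
    [Group A] extends PathTransport Y A where
  f : C(Y, X)
  surj : Function.Surjective f
  joinedIn_fiber : ∀ y y', f y = f y' → JoinedIn (f ⁻¹' {f y}) y y'
  exists_nhds : ∀ x, ∀ U ∈ 𝓝 x, ∃ V ⊆ U, IsOpen V ∧ x ∈ V ∧ IsPathConnected (f ⁻¹' V) ∧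
    ∀ y (p : Path y y), (∀ t, f (p t) ∈ V) → val p = 1

namespace LocallyTrivialTransport

variable {Y X A : Type*} [TopologicalSpace Y] [TopologicalSpace X] [Group A]
  (T : LocallyTrivialTransport Y X A)

theorem exists_baseSet (x : X) : ∃ V : Set X, IsOpen V ∧ x ∈ V ∧ IsPathConnected (T.f ⁻¹' V) ∧
    ∀ y (p : Path y y), (∀ t, T.f (p t) ∈ V) → T.val p = 1 :=
  let ⟨V, _, h⟩ := T.exists_nhds x univ univ_mem
  ⟨V, h⟩

/-- A neighbourhood of `x` over which the transport is trivial. -/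
def baseSet (x : X) : Set X := (T.exists_baseSet x).choose

theorem isOpen_baseSet (x : X) : IsOpen (T.baseSet x) := (T.exists_baseSet x).choose_spec.1

theorem mem_baseSet (x : X) : x ∈ T.baseSet x := (T.exists_baseSet x).choose_spec.2.1

theorem isPathConnected_baseSet (x : X) : IsPathConnected (T.f ⁻¹' T.baseSet x) :=
  (T.exists_baseSet x).choose_spec.2.2.1

theorem val_eq {x : X} {y y' : Y} (p q : Path y y') (hp : ∀ t, T.f (p t) ∈ T.baseSet x)
    (hq : ∀ t, T.f (q t) ∈ T.baseSet x) : T.val p = T.val q := by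
  have h := (T.exists_baseSet x).choose_spec.2.2.2 y (p.trans q.symm) fun t => by
    have : p.trans q.symm t ∈ range p ∪ range q := by
      rw [← Path.symm_range q, ← Path.trans_range]
      exact mem_range_self t
    rcases this with ⟨s, hs⟩ | ⟨s, hs⟩
    · rw [← hs]; exact hp s
    · rw [← hs]; exact hq s
  rw [T.val_trans, T.val_symm] at h
  exact mul_inv_eq_one.1 h

/-- A set-theoretic section of `f`. -/
noncomputable def point (x : X) : Y := Function.surjInv T.surj x

theorem f_point (x : X) : T.f (T.point x) = x := Function.surjInv_eq T.surj x

open scoped Classical in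
/-- The transport from the marked point over `x` to the marked point over `b` within
the preimage of `baseSet x`. -/
noncomputable def coord (x b : X) : A :=
  if h : b ∈ T.baseSet x then T.val ((T.isPathConnected_baseSet x).joinedIn (T.point x)
    (by rw [mem_preimage, f_point]; exact T.mem_baseSet x) (T.point b)
    (by rwa [mem_preimage, f_point])).somePath
  else 1

theorem coord_eq {x b : X} (p : Path (T.point x) (T.point b))
    (hp : ∀ t, T.f (p t) ∈ T.baseSet x) : T.coord x b = T.val p := by
  have hb : b ∈ T.baseSet x := by have := hp 1; rwa [p.target, f_point] at this
  rw [coord, dif_pos hb]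
  refine T.val_eq (x := x) _ _ (fun t => ?_) hp
  exact mem_preimage.1 (JoinedIn.somePath_mem _ t)

theorem exists_path_coord {x b : X} (hb : b ∈ T.baseSet x) :
    ∃ p : Path (T.point x) (T.point b), ∀ t, T.f (p t) ∈ T.baseSet x := by
  have h := (T.isPathConnected_baseSet x).joinedIn (T.point x)
    (by rw [mem_preimage, f_point]; exact T.mem_baseSet x) (T.point b)
    (by rwa [mem_preimage, f_point])
  exact ⟨h.somePath, fun t => h.somePath_mem t⟩

theorem coord_mul_val {x b b' : X} (hb : b ∈ T.baseSet x) (p : Path (T.point b) (T.point b'))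
    (hp : ∀ t, T.f (p t) ∈ T.baseSet x) : T.coord x b' = T.coord x b * T.val p := by
  obtain ⟨q, hq⟩ := T.exists_path_coord hb
  rw [T.coord_eq q hq, ← T.val_trans]
  refine T.coord_eq _ fun t => ?_
  have : q.trans p t ∈ range q ∪ range p := by
    rw [← Path.trans_range]; exact mem_range_self t
  rcases this with ⟨s, hs⟩ | ⟨s, hs⟩
  · rw [← hs]; exact hq s
  · rw [← hs]; exact hp s

/-- Transition functions are locally constant: moving from `b` to a nearby `b'` along a path lying
over both base sets multiplies both coordinates on the right by the same element, which cancels. -/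
theorem eventually_coord_eq (i j b : X) (hi : b ∈ T.baseSet i) (hj : b ∈ T.baseSet j) :
    ∀ᶠ b' in 𝓝 b, T.coord j b' * (T.coord i b')⁻¹ = T.coord j b * (T.coord i b)⁻¹ := by
  obtain ⟨V, hV, hVo, hbV, hVp, -⟩ := T.exists_nhds b (T.baseSet i ∩ T.baseSet j)
    (inter_mem ((T.isOpen_baseSet i).mem_nhds hi) ((T.isOpen_baseSet j).mem_nhds hj))
  filter_upwards [hVo.mem_nhds hbV] with b' hb'
  have h := hVp.joinedIn (T.point b) (by rwa [mem_preimage, f_point]) (T.point b')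
    (by rwa [mem_preimage, f_point])
  rw [T.coord_mul_val hi h.somePath fun t => (hV (h.somePath_mem t)).1,
    T.coord_mul_val hj h.somePath fun t => (hV (h.somePath_mem t)).2]
  group

/-- A path within a fibre to the marked point. -/
noncomputable def fiberPath (y : Y) : Path y (T.point (T.f y)) :=
  (T.joinedIn_fiber y (T.point (T.f y)) (T.f_point _).symm).somePath

theorem f_fiberPath (y : Y) (t : I) : T.f (T.fiberPath y t) = T.f y :=
  (T.joinedIn_fiber y (T.point (T.f y)) (T.f_point _).symm).somePath_mem t

variable [TopologicalSpace A] [DiscreteTopology A]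

/-- The bundle with discrete fibre `A` over `X` determined by the transport. -/
noncomputable def core : FiberBundleCore X X A where
  baseSet := T.baseSet
  isOpen_baseSet := T.isOpen_baseSet
  indexAt := id
  mem_baseSet_at := T.mem_baseSet
  coordChange i j b a := T.coord j b * (T.coord i b)⁻¹ * a
  coordChange_self i b _ a := by simp
  continuousOn_coordChange i j := by
    rintro ⟨b, a⟩ ⟨⟨hi, hj⟩, -⟩
    have h1 : ContinuousAt (fun q : X × A => T.coord j b * (T.coord i b)⁻¹ * q.2) (b, a) :=
      (continuous_of_discreteTopology (f := fun z : A => T.coord j b * (T.coord i b)⁻¹ * z)).comp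
        continuous_snd |>.continuousAt
    refine (h1.congr ?_).continuousWithinAt
    filter_upwards [continuousAt_fst.eventually (T.eventually_coord_eq i j b hi hj)] with q hq
    rw [hq]
  coordChange_comp i j k b _ a := by group

theorem isCoveringMap_proj : IsCoveringMap (Bundle.TotalSpace.proj (F := A) (E := T.core.Fiber)) :=
  FiberBundle.isCoveringMap

/-- The lift to the total space of `core` of the image under `f` of a path in `Y`. -/
noncomputable def lift {y y' : Y} (δ : Path y y') (c : A) (t : I) :
    Bundle.TotalSpace A T.core.Fiber :=
  ⟨T.f (δ t), (T.coord (T.f (δ t)) (T.f (δ t)) *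
    (T.val (δ.subpath 0 t) * T.val (T.fiberPath (δ t)))⁻¹ * c : A)⟩

/-- Marked points do not vary continuously, but in the chart centred at `f (δ t₀)` the fibre
coordinate is constant near `t₀`. There `coord` can be computed along the path from the marked point
back to `δ t₀`, along `δ` to `δ t`, then out to the marked point below it, and the `t`-dependent
factors cancel. -/
theorem continuous_lift {y y' : Y} (δ : Path y y') (c : A) : Continuous (T.lift δ c) := by
  rw [continuous_iff_continuousAt]
  intro t₀
  rw [FiberBundle.continuousAt_totalSpace]
  refine ⟨(T.f.continuous.comp δ.continuous).continuousAt, ?_⟩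
  refine ContinuousAt.congr (f := fun _ : I => (T.val (T.fiberPath (δ t₀)))⁻¹ *
    (T.val (δ.subpath 0 t₀))⁻¹ * c) continuousAt_const ?_
  have hopen : IsOpen ((fun t => T.f (δ t)) ⁻¹' T.baseSet (T.f (δ t₀))) :=
    (T.isOpen_baseSet _).preimage (T.f.continuous.comp δ.continuous)
  obtain ⟨b, c', hbc, hWn, hW⟩ :=
    exists_Icc_mem_subset_of_mem_nhds (hopen.mem_nhds (T.mem_baseSet (T.f (δ t₀))))
  filter_upwards [hWn] with t ht
  change _ = T.coord (T.f (δ t₀)) (T.f (δ t)) * (T.coord (T.f (δ t)) (T.f (δ t)))⁻¹ *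
    (T.coord (T.f (δ t)) (T.f (δ t)) *
    (T.val (δ.subpath 0 t) * T.val (T.fiberPath (δ t)))⁻¹ * c)
  have hsub : ∀ s, T.f (δ.subpath t₀ t s) ∈ T.baseSet (T.f (δ t₀)) := by
    intro s
    have h1 : δ.subpath t₀ t s ∈ δ '' uIcc t₀ t := by
      rw [← Path.range_subpath]; exact mem_range_self s
    obtain ⟨r, hr, hrs⟩ := h1
    rw [← hrs]
    exact hW (ordConnected_Icc.uIcc_subset hbc ht hr)
  rw [T.coord_eq ((T.fiberPath (δ t₀)).symm.trans ((δ.subpath t₀ t).trans (T.fiberPath (δ t))))]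
  · rw [T.val_trans, T.val_trans, T.val_symm, ← T.val_subpath δ 0 t₀ t]
    group
  · intro s
    have : (T.fiberPath (δ t₀)).symm.trans ((δ.subpath t₀ t).trans (T.fiberPath (δ t))) s ∈
        range (T.fiberPath (δ t₀)) ∪ (range (δ.subpath t₀ t) ∪ range (T.fiberPath (δ t))) := by
      rw [← Path.trans_range, ← Path.symm_range, ← Path.trans_range]; exact mem_range_self s
    rcases this with ⟨r, hr⟩ | ⟨r, hr⟩ | ⟨r, hr⟩
    · rw [← hr, f_fiberPath]; exact T.mem_baseSet _
    · rw [← hr]; exact hsub r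
    · rw [← hr, f_fiberPath]
      have := hsub 1
      rwa [Path.target] at this

theorem lift_zero {y y' : Y} (δ : Path y y') (c : A) :
    T.lift δ c 0 = ⟨T.f y, (T.coord (T.f y) (T.f y) * (T.val (T.fiberPath y))⁻¹ * c : A)⟩ := by
  have h : ∀ z, ∀ hz : z = y, (⟨T.f z, (T.coord (T.f z) (T.f z) *
      (T.val (T.fiberPath z))⁻¹ * c : A)⟩ : Bundle.TotalSpace A T.core.Fiber) =
      ⟨T.f y, (T.coord (T.f y) (T.f y) * (T.val (T.fiberPath y))⁻¹ * c : A)⟩ := by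
    rintro _ rfl; rfl
  rw [lift, ← h _ δ.source, Path.subpath_self, T.val_refl, one_mul]

theorem lift_one {y : Y} (δ : Path y y) (c : A) :
    T.lift δ c 1 = ⟨T.f y, (T.coord (T.f y) (T.f y) * (T.val (T.fiberPath y))⁻¹ *
      (T.val δ)⁻¹ * c : A)⟩ := by
  have h : ∀ z, ∀ hz : z = y, ∀ v : A, (⟨T.f z, (T.coord (T.f z) (T.f z) *
      (v * T.val (T.fiberPath z))⁻¹ * c : A)⟩ : Bundle.TotalSpace A T.core.Fiber) =
      ⟨T.f y, (T.coord (T.f y) (T.f y) * (v * T.val (T.fiberPath y))⁻¹ * c : A)⟩ := by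
    rintro _ rfl _; rfl
  rw [lift, h _ δ.target, Path.subpath_zero_one, T.val_cast]
  simp [mul_assoc]

end LocallyTrivialTransport

/-- A homomorphism from the fundamental group of `Y` to `A` which is trivial on loops lying over
small open sets of `X` is the monodromy of a covering of `X` with fibre `A`. -/
theorem exists_isCoveringMap_monodromy {Y : Type*} {X : Type uM} {A : Type uG}
    [TopologicalSpace Y] [PathConnectedSpace Y] [TopologicalSpace X] [Group A] (f : C(Y, X))
    (hf : Function.Surjective f) (hfib : ∀ y y', f y = f y' → JoinedIn (f ⁻¹' {f y}) y y')
    (y₀ : Y) (φ : FundamentalGroup Y y₀ →* A)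
    (hloc : ∀ x, ∀ U ∈ 𝓝 x, ∃ V ⊆ U, IsOpen V ∧ x ∈ V ∧ IsPathConnected (f ⁻¹' V) ∧
      ∀ y (p : Path y y) (γ : Path y₀ y), (∀ t, f (p t) ∈ V) →
        φ (FundamentalGroup.fromPath (.mk (γ.trans (p.trans γ.symm)))) = 1) :
    ∃ (E : Type max uM uG) (_ : TopologicalSpace E) (p : E → X) (cov : IsCoveringMap p)
      (θ : p ⁻¹' {f y₀} ≃ A), Function.Surjective p ∧
      ∀ (δ : FundamentalGroup Y y₀) (e : p ⁻¹' {f y₀}),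
        θ (cov.monodromy (Path.Homotopic.Quotient.map δ.toPath f) e) = φ δ * θ e := by
  let : TopologicalSpace A := ⊥
  have : DiscreteTopology A := ⟨rfl⟩
  let γ : ∀ y, Path y₀ y := fun y => PathConnectedSpace.somePath y₀ y
  let T : LocallyTrivialTransport Y X A :=
    { PathTransport.ofHom φ γ with
      f := f
      surj := hf
      joinedIn_fiber := hfib
      exists_nhds := fun x U hU => by
        obtain ⟨V, h1, h2, h3, h4, h5⟩ := hloc x U hU
        exact ⟨V, h1, h2, h3, h4, fun y p hp => inv_eq_one.2 (h5 y p (γ y) hp)⟩ }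
  let W : A := T.coord (f y₀) (f y₀) * (T.val (T.fiberPath y₀))⁻¹
  let g₀ : FundamentalGroup Y y₀ := FundamentalGroup.fromPath (.mk (γ y₀))
  -- The chosen path `γ y₀` may be a nontrivial loop, so `T.val δ` involves a conjugate of `φ δ` by
  -- `φ g₀`, and fibre coordinates add a conjugation by `W`. Left translation by `w⁻¹` removes both.
  let w : A := W * (φ g₀)⁻¹
  let θ₀ : (Bundle.TotalSpace.proj (F := A) (E := T.core.Fiber)) ⁻¹' {f y₀} ≃ A :=
    { toFun := fun e => e.1.2
      invFun := fun a => ⟨⟨f y₀, a⟩, rfl⟩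
      left_inv := by
        rintro ⟨⟨x, a⟩, h⟩
        obtain rfl : x = f y₀ := h
        rfl
      right_inv := fun a => rfl }
  have cov := T.isCoveringMap_proj
  refine ⟨_, inferInstance, _, cov, θ₀.trans (Equiv.mulLeft w⁻¹),
    fun x => ⟨⟨x, (1 : A)⟩, rfl⟩, ?_⟩
  intro δ e
  obtain ⟨δ, rfl⟩ := Path.Homotopic.Quotient.mk_surjective δ
  have hval : (T.val δ)⁻¹ = (φ g₀)⁻¹ * φ (FundamentalGroup.fromPath (.mk δ)) * φ g₀ := by
    rw [← map_inv, ← map_mul, ← map_mul]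
    exact inv_inv _
  -- The constant `W⁻¹ * θ₀ e` is chosen so that the explicit lift starts at `e`.
  have hend : cov.monodromy (.mk (δ.map f.continuous)) e = θ₀.symm (W * (T.val δ)⁻¹ * W⁻¹ * θ₀ e) := by
    refine cov.monodromy_eq_of_map_eq (.mk
      { toFun := T.lift δ (W⁻¹ * θ₀ e)
        continuous_toFun := T.continuous_lift δ _
        source' := ?_
        target' := ?_ }) ?_
    · rw [T.lift_zero]
      refine Eq.trans ?_ congr(Subtype.val $(θ₀.symm_apply_apply e))
      change _ = (⟨f y₀, θ₀ e⟩ : Bundle.TotalSpace A T.core.Fiber)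
      congr 1
      exact mul_inv_cancel_left W (θ₀ e)
    · rw [T.lift_one]
      change _ = (⟨f y₀, _⟩ : Bundle.TotalSpace A T.core.Fiber)
      congr 1
      simp only [mul_assoc, W]
      rfl
    · refine congr_arg Path.Homotopic.Quotient.mk ?_
      ext t
      rfl
  change w⁻¹ * θ₀ (cov.monodromy (.mk (δ.map f.continuous)) e) = φ _ * (w⁻¹ * θ₀ e)
  rw [hend, Equiv.apply_symm_apply, hval]
  simp only [w, mul_inv_rev, inv_inv]
  group

end CoveringOfHom

/-! ### Concatenation of path classes under casts and maps. -/

section PathClasses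

open Path.Homotopic

theorem Path.Homotopic.Quotient.cast_trans_cast {X : Type*} [TopologicalSpace X]
    {x y z x' y' z' : X} (p : Path.Homotopic.Quotient x y) (q : Path.Homotopic.Quotient y z)
    (hx : x' = x) (hy : y' = y) (hz : z' = z) :
    (p.cast hx hy).trans (q.cast hy hz) = (p.trans q).cast hx hz := by
  subst hx hy hz; simp

theorem Path.Homotopic.Quotient.map_trans {X Y : Type*} [TopologicalSpace X] [TopologicalSpace Y]
    {x y z : X} (p : Path.Homotopic.Quotient x y) (q : Path.Homotopic.Quotient y z) (f : C(X, Y)) :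
    (p.trans q).map f = (p.map f).trans (q.map f) := by
  induction p, q using Path.Homotopic.Quotient.ind₂ with
  | mk p q =>
    rw [← mk_trans, ← mk_map, ← mk_map, ← mk_map, Path.map_trans, mk_trans]

end PathClasses

theorem pathConnectedSpace_of_chartedSpace (k : ℕ) (X : Type*) [TopologicalSpace X]
    [ChartedSpace (EuclideanSpace ℝ (Fin k)) X] [ConnectedSpace X] : PathConnectedSpace X := by
  have : LocallyPathConnectedSpace X :=
    ChartedSpace.locallyPathConnectedSpace (EuclideanSpace ℝ (Fin k)) X
  rwa [pathConnectedSpace_iff_connectedSpace]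

/-! ### Fundamental groups of a principal bundle: centrality and exactness. -/

namespace IsPrincipalBundle

open Set Topology Filter unitInterval

variable {n k d : ℕ}
  {M : Type uM} [TopologicalSpace M] [ChartedSpace (EuclideanSpace ℝ (Fin n)) M]
  {G : Type uG} [Group G] [TopologicalSpace G] [ChartedSpace (EuclideanSpace ℝ (Fin k)) G]
  {P : Type uP} [TopologicalSpace P] [ChartedSpace (EuclideanSpace ℝ (Fin d)) P]
  [MulAction Gᵐᵒᵖ P] {π : P → M}

section Trivialization

variable {e : Bundle.Trivialization G π}

theorem symm_mul (he : ∀ m ∈ e.baseSet, ∀ g : G, e.toOpenPartialHomeomorph.symm (m, g) =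
      MulOpposite.op g • e.toOpenPartialHomeomorph.symm (m, (1 : G))) {m : M} (hm : m ∈ e.baseSet)
    (g g' : G) : e.toOpenPartialHomeomorph.symm (m, g * g') =
      MulOpposite.op g' • e.toOpenPartialHomeomorph.symm (m, g) := by
  rw [he m hm, he m hm g, MulOpposite.op_mul, mul_smul]

theorem trivialization_smul
    (he : ∀ m ∈ e.baseSet, ∀ g : G, e.toOpenPartialHomeomorph.symm (m, g) =
      MulOpposite.op g • e.toOpenPartialHomeomorph.symm (m, (1 : G)))
    {p : P} (hp : π p ∈ e.baseSet) (g : G) :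
    e (MulOpposite.op g • p) = (π p, (e p).2 * g) := by
  have h1 : e.toOpenPartialHomeomorph.symm (π p, (e p).2) = p :=
    e.symm_apply_mk_proj (e.mem_source.2 hp)
  conv_lhs => rw [← h1, ← symm_mul he hp]
  exact e.apply_symm_apply' hp

end Trivialization

theorem continuous_smul (h : IsPrincipalBundle n k d G π) :
    Continuous (fun x : P × G => MulOpposite.op x.2 • x.1) := h.smooth_action.continuous

theorem isOpenMap_proj (h : IsPrincipalBundle n k d G π) : IsOpenMap π := by
  rw [isOpenMap_iff_nhds_le]
  intro p
  obtain ⟨e, hm, -⟩ := h.locally_trivial (π p)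
  exact (e.map_proj_nhds (e.mem_source.2 hm)).ge

theorem preimage_singleton (h : IsPrincipalBundle n k d G π) (p : P) :
    π ⁻¹' {π p} = range (h.orbitMap p) := by
  ext p'
  constructor
  · intro hp'
    obtain ⟨g, hg⟩ := h.transitive p p' (mem_singleton_iff.1 hp').symm
    exact ⟨g, hg⟩
  · rintro ⟨g, rfl⟩
    exact h.proj_action p g

/-- The projection is an open quotient map with connected fibres onto a connected base, so the total
space is connected; being locally Euclidean, it is path connected. -/
theorem pathConnectedSpace (h : IsPrincipalBundle n k d G π) [ConnectedSpace M]
    [ConnectedSpace G] : PathConnectedSpace P := by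
  have : LocallyPathConnectedSpace P :=
    ChartedSpace.locallyPathConnectedSpace (EuclideanSpace ℝ (Fin d)) P
  rw [pathConnectedSpace_iff_connectedSpace, connectedSpace_iff_univ]
  have hq : IsQuotientMap π :=
    (h.isOpenMap_proj).isQuotientMap h.smooth_proj.continuous h.surjective_proj
  refine preimage_univ (f := π) ▸ IsCoinducing.isConnected_preimage_of_isClosed (fun t => ?_)
    hq.isCoinducing isClosed_univ isConnected_univ
  · obtain ⟨p, rfl⟩ := h.surjective_proj t
    rw [h.preimage_singleton]
    exact isConnected_range (h.orbitMap p).continuous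

theorem joinedIn_fiber (h : IsPrincipalBundle n k d G π) [PathConnectedSpace G] (p p' : P)
    (hp : π p = π p') : JoinedIn (π ⁻¹' {π p}) p p' := by
  obtain ⟨g, rfl⟩ := h.transitive p p' hp
  refine ⟨((PathConnectedSpace.somePath 1 g).map (h.orbitMap p).continuous).cast
    (h.orbitMap_one p).symm rfl, fun t => ?_⟩
  exact h.proj_action p _

theorem orbitPi1_mk (h : IsPrincipalBundle n k d G π) (p : P) (l : Path (1 : G) 1) :
    h.orbitPi1 p (FundamentalGroup.fromPath (.mk l)) =
      FundamentalGroup.fromPath (.mk ((l.map (h.orbitMap p).continuous).cast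
        (h.orbitMap_one p).symm (h.orbitMap_one p).symm)) :=
  FundamentalGroup.mapOfEq_apply ..

/-- Loops in the fibre through `p` and through `p'` given by the same loop in the group are
conjugate by any path from `p` to `p'`. -/
theorem trans_orbitPi1 (h : IsPrincipalBundle n k d G π) {p p' : P}
    (γ : Path.Homotopic.Quotient p p') (a : FundamentalGroup G 1) :
    γ.trans (h.orbitPi1 p' a).toPath = (h.orbitPi1 p a).toPath.trans γ := by
  obtain ⟨l, rfl⟩ := Path.Homotopic.Quotient.mk_surjective a
  obtain ⟨γ, rfl⟩ := Path.Homotopic.Quotient.mk_surjective γ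
  -- Both concatenations are images under the action of paths in `P × G`, where moving in `P` and
  -- moving in `G` commute up to homotopy.
  let act : C(P × G, P) := ⟨_, h.continuous_smul⟩
  have hone : ∀ q : P, q = act (q, 1) := fun q => (one_smul Gᵐᵒᵖ q).symm
  have hγ : Path.Homotopic.Quotient.mk γ =
      ((Path.Homotopic.prod (.mk γ) (.refl 1)).map act).cast (hone p) (hone p') := by
    refine congr_arg Path.Homotopic.Quotient.mk (Path.ext (funext fun t => ?_))
    exact hone _
  have ho : ∀ q : P, (h.orbitPi1 q (FundamentalGroup.fromPath (.mk l))).toPath =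
      ((Path.Homotopic.prod (.refl q) (.mk l)).map act).cast (hone q) (hone q) := by
    intro q
    rw [orbitPi1_mk]
    refine congr_arg Path.Homotopic.Quotient.mk (Path.ext (funext fun t => ?_))
    rfl
  erw [ho p, ho p', hγ]
  rw [Path.Homotopic.Quotient.cast_trans_cast, Path.Homotopic.Quotient.cast_trans_cast,
    ← Path.Homotopic.Quotient.map_trans, ← Path.Homotopic.Quotient.map_trans,
    Path.Homotopic.comp_prod_eq_prod_comp, Path.Homotopic.comp_prod_eq_prod_comp]
  simp

/-- The image of the fundamental group of the structure group is central. -/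
theorem orbitPi1_comm (h : IsPrincipalBundle n k d G π) (p₀ : P) (a : FundamentalGroup P p₀)
    (b : FundamentalGroup G 1) : a * h.orbitPi1 p₀ b = h.orbitPi1 p₀ b * a :=
  (h.trans_orbitPi1 a.toPath b).symm

theorem projPi1_orbitPi1 (h : IsPrincipalBundle n k d G π) (p₀ : P) (b : FundamentalGroup G 1) :
    h.projPi1 p₀ (h.orbitPi1 p₀ b) = 1 := by
  obtain ⟨l, rfl⟩ := Path.Homotopic.Quotient.mk_surjective b
  erw [orbitPi1_mk]
  refine congr_arg Path.Homotopic.Quotient.mk (Path.ext (funext fun t => ?_))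
  exact h.proj_action p₀ (l t)

/-- A loop over a simply connected trivialising open set is homotopic to a loop in a fibre. -/
theorem exists_eq_orbitPi1 (h : IsPrincipalBundle n k d G π) [IsTopologicalGroup G]
    {e : Bundle.Trivialization G π}
    (he : ∀ m ∈ e.baseSet, ∀ g : G, e.toOpenPartialHomeomorph.symm (m, g) =
      MulOpposite.op g • e.toOpenPartialHomeomorph.symm (m, (1 : G)))
    {V : Set M} (hV : V ⊆ e.baseSet) (hVs : IsSimplyConnected V) {y : P} (p : Path y y)
    (hp : ∀ t, π (p t) ∈ V) :
    ∃ a : FundamentalGroup G 1, FundamentalGroup.fromPath (.mk p) = h.orbitPi1 y a := by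
  have := hVs.simplyConnectedSpace
  have hy : π y ∈ V := by simpa using hp 0
  have hec : Continuous fun t => (e (p t)).2 :=
    continuous_snd.comp (e.continuousOn_toFun.comp_continuous p.continuous
      fun t => e.mem_source.2 (hV (hp t)))
  set g := (e y).2 with hg
  -- In the trivialisation `p` is the pair of its projection `p₁` and its fibre coordinate `g * l`;
  -- contracting `p₁` in `V` leaves the loop `l` in the fibre through `y`.
  let l : Path (1 : G) 1 :=
    { toFun := fun t => g⁻¹ * (e (p t)).2
      continuous_toFun := continuous_const.mul hec
      source' := by simp [hg]
      target' := by simp [hg] }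
  let p₁ : Path (⟨π y, hy⟩ : V) ⟨π y, hy⟩ :=
    { toFun := fun t => ⟨π (p t), hp t⟩
      continuous_toFun := (h.smooth_proj.continuous.comp p.continuous).subtype_mk _
      source' := by simp
      target' := by simp }
  let Ψ : C(V × G, P) :=
    ⟨fun x => e.toOpenPartialHomeomorph.symm (x.1, g * x.2),
      e.toOpenPartialHomeomorph.continuousOn_symm.comp_continuous
        (by fun_prop) fun x => e.mem_target.2 (hV x.1.2)⟩
  have hΨ : y = Ψ (⟨π y, hy⟩, 1) := by
    change y = e.toOpenPartialHomeomorph.symm (π y, g * 1)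
    rw [mul_one]
    exact (e.symm_apply_mk_proj (e.mem_source.2 (hV hy))).symm
  refine ⟨FundamentalGroup.fromPath (.mk l), ?_⟩
  rw [orbitPi1_mk]
  refine Path.Homotopic.Quotient.eq.2 ?_
  have h1 : ((p₁.prod l).map Ψ.continuous).Homotopic
      (((Path.refl _).prod l).map Ψ.continuous) := by
    refine Path.Homotopic.map ?_ Ψ
    obtain ⟨H⟩ := SimplyConnectedSpace.paths_homotopic p₁ (Path.refl _)
    exact ⟨Path.Homotopic.prodHomotopy H (Path.Homotopy.refl l)⟩
  have h2 := h1.pathCast hΨ hΨ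
  convert h2 using 1
  · ext t
    change p t = e.toOpenPartialHomeomorph.symm (π (p t), g * (g⁻¹ * (e (p t)).2))
    rw [mul_inv_cancel_left]
    exact (e.symm_apply_mk_proj (e.mem_source.2 (hV (hp t)))).symm
  · ext t
    change MulOpposite.op (l t) • y = e.toOpenPartialHomeomorph.symm (π y, g * l t)
    rw [symm_mul he (hV hy)]
    congr 1
    exact (e.symm_apply_mk_proj (e.mem_source.2 (hV hy))).symm

/-- The range of `i_*` is normal because it is central, and loops over small open sets are conjugate
into it. So the quotient homomorphism is the monodromy of a covering of `M`. If `a` projects to the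
trivial class, its monodromy is the identity, yet it is also left translation by the class of `a`.
-/
theorem mem_range_orbitPi1 (h : IsPrincipalBundle n k d G π) [IsTopologicalGroup G]
    [ConnectedSpace M] [ConnectedSpace G] (p₀ : P) {a : FundamentalGroup P p₀}
    (ha : h.projPi1 p₀ a = 1) : a ∈ (h.orbitPi1 p₀).range := by
  have := h.pathConnectedSpace
  have := pathConnectedSpace_of_chartedSpace k G
  have hnormal : (h.orbitPi1 p₀).range.Normal := ⟨by
    rintro _ ⟨b, rfl⟩ c
    rw [h.orbitPi1_comm, mul_inv_cancel_right]
    exact ⟨b, rfl⟩⟩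
  obtain ⟨E, _, q, cov, θ, hq, hθ⟩ := exists_isCoveringMap_monodromy h.projMap h.surjective_proj
    h.joinedIn_fiber p₀ (QuotientGroup.mk' (h.orbitPi1 p₀).range) (fun m U hU => by
      obtain ⟨e, hm, -, -, he⟩ := h.locally_trivial m
      obtain ⟨V, hVU, hVo, hmV, hVs⟩ := exists_isSimplyConnected_nhds
        (E := EuclideanSpace ℝ (Fin n)) m (inter_mem hU (e.open_baseSet.mem_nhds hm))
      have hVe : V ⊆ e.baseSet := fun z hz => (hVU hz).2
      refine ⟨V, fun z hz => (hVU hz).1, hVo, hmV, ?_, fun y p γ hp => ?_⟩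
      · have h1 : IsPathConnected (V ×ˢ (univ : Set G)) :=
          hVs.isPathConnected.prod isPathConnected_univ
        have h2 := h1.image' (f := e.toOpenPartialHomeomorph.symm)
          (e.toOpenPartialHomeomorph.continuousOn_symm.mono fun x hx => e.mem_target.2 (hVe hx.1))
        convert h2 using 1
        ext z
        constructor
        · intro hz
          exact ⟨(π z, (e z).2), ⟨hz, mem_univ _⟩, e.symm_apply_mk_proj (e.mem_source.2 (hVe hz))⟩
        · rintro ⟨x, hx, rfl⟩
          change π _ ∈ V
          rw [e.proj_symm_apply (e.mem_target.2 (hVe hx.1))]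
          exact hx.1
      · obtain ⟨b, hb⟩ := h.exists_eq_orbitPi1 he hVe hVs p hp
        refine (QuotientGroup.eq_one_iff _).2 ⟨b, ?_⟩
        have hb' : Path.Homotopic.Quotient.mk p = (h.orbitPi1 y b).toPath := hb
        change _ = (Path.Homotopic.Quotient.mk γ).trans
          ((Path.Homotopic.Quotient.mk p).trans (Path.Homotopic.Quotient.mk γ).symm)
        rw [hb', ← Path.Homotopic.Quotient.trans_assoc, h.trans_orbitPi1,
          Path.Homotopic.Quotient.trans_assoc, Path.Homotopic.Quotient.trans_symm,
          Path.Homotopic.Quotient.trans_refl])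
  obtain ⟨x, hx⟩ := hq (h.projMap p₀)
  have h1 := hθ a ⟨x, hx⟩
  have h2 : Path.Homotopic.Quotient.map a.toPath h.projMap = .refl _ := ha
  rw [h2, cov.monodromy_refl, id] at h1
  exact (QuotientGroup.eq_one_iff a).1 (right_eq_mul.1 h1)

/-- Short pieces of a loop lift with constant fibre coordinate in a trivialisation. The concatenated
lift ends in the fibre through `p₀` and is closed up inside that path-connected fibre. -/
theorem surjective_projPi1 (h : IsPrincipalBundle n k d G π) [ConnectedSpace G] (p₀ : P) :
    Function.Surjective (h.projPi1 p₀) := by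
  have := pathConnectedSpace_of_chartedSpace k G
  intro b
  obtain ⟨γ, rfl⟩ := Path.Homotopic.Quotient.mk_surjective b
  -- Liftability from `s` to `t`, for every starting point, is a transitive relation that holds
  -- locally in both directions, hence everywhere on the connected interval.
  have key : ∀ s t : I, ∀ p, ∀ hp : π p = γ s, ∃ (p' : P) (hp' : π p' = γ t) (δ : Path p p'),
      Path.Homotopic.Quotient.map (.mk δ) h.projMap =
        (Path.Homotopic.Quotient.mk (γ.subpath s t)).cast hp hp' := by
    refine PreconnectedSpace.induction₂' _ (fun t₀ => ?_) ⟨fun r s t hrs hst p hp => ?_⟩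
    · obtain ⟨e, hm, -⟩ := h.locally_trivial (γ t₀)
      obtain ⟨b, c, hbc, hWn, hW⟩ := exists_Icc_mem_subset_of_mem_nhds
        ((e.open_baseSet.preimage γ.continuous).mem_nhds hm)
      have lift : ∀ s ∈ Icc b c, ∀ t ∈ Icc b c, ∀ p, ∀ hp : π p = γ s,
          ∃ (p' : P) (hp' : π p' = γ t) (δ : Path p p'),
            Path.Homotopic.Quotient.map (.mk δ) h.projMap =
              (Path.Homotopic.Quotient.mk (γ.subpath s t)).cast hp hp' := by
        intro s hs t ht p hp
        have hsub : ∀ r, γ.subpath s t r ∈ e.baseSet := by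
          intro r
          have h1 : γ.subpath s t r ∈ γ '' uIcc s t := by
            rw [← Path.range_subpath]; exact mem_range_self r
          obtain ⟨r', hr', hrr'⟩ := h1
          rw [← hrr']
          exact hW (ordConnected_Icc.uIcc_subset hs ht hr')
        have hpe : π p ∈ e.baseSet := by rw [hp]; exact hW hs
        have hproj : ∀ r, π (e.toOpenPartialHomeomorph.symm (γ.subpath s t r, (e p).2)) =
            γ.subpath s t r := fun r => e.proj_symm_apply' (hsub r)
        refine ⟨e.toOpenPartialHomeomorph.symm (γ t, (e p).2), e.proj_symm_apply' (hW ht),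
          { toFun := fun r => e.toOpenPartialHomeomorph.symm (γ.subpath s t r, (e p).2)
            continuous_toFun := e.toOpenPartialHomeomorph.continuousOn_symm.comp_continuous
              (by fun_prop) fun r => e.mem_target.2 (hsub r)
            source' := by
              rw [Path.source, ← hp]
              exact e.symm_apply_mk_proj (e.mem_source.2 hpe)
            target' := by rw [Path.target] }, ?_⟩
        exact congr_arg Path.Homotopic.Quotient.mk (Path.ext (funext fun r => hproj r))
      filter_upwards [hWn] with t ht
      exact ⟨lift t₀ hbc t ht, lift t ht t₀ hbc⟩
    · obtain ⟨p', hp', δ, hδ⟩ := hrs p hp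
      obtain ⟨p'', hp'', δ', hδ'⟩ := hst p' hp'
      refine ⟨p'', hp'', δ.trans δ', ?_⟩
      rw [Path.Homotopic.Quotient.mk_trans, Path.Homotopic.Quotient.map_trans, hδ, hδ']
      refine (Path.Homotopic.Quotient.cast_trans_cast _ _ hp hp' hp'').trans ?_
      rw [← Path.Homotopic.Quotient.mk_trans]
      congr 1
      exact Path.Homotopic.Quotient.eq.2 ⟨Path.Homotopy.subpathTransSubpath γ r s t⟩
  obtain ⟨p', hp', δ, hδ⟩ := key 0 1 p₀ γ.source.symm
  have hJ := h.joinedIn_fiber p' p₀ (hp'.trans γ.target)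
  refine ⟨FundamentalGroup.fromPath (.mk (δ.trans hJ.somePath)), ?_⟩
  change Path.Homotopic.Quotient.map (.mk (δ.trans hJ.somePath)) h.projMap = _
  have hc : Path.Homotopic.Quotient.map (.mk hJ.somePath) h.projMap =
      (Path.Homotopic.Quotient.refl _).cast rfl (hp'.trans γ.target).symm := by
    refine congr_arg Path.Homotopic.Quotient.mk (Path.ext (funext fun r => ?_))
    exact hJ.somePath_mem r
  rw [Path.Homotopic.Quotient.mk_trans, Path.Homotopic.Quotient.map_trans, hδ, hc,
    Path.subpath_zero_one, Path.Homotopic.Quotient.mk_cast]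
  have hgen : ∀ {x y z w : M} (p : Path.Homotopic.Quotient x y) (hz : z = x) (hy : w = y)
      (hw : y = w), (p.cast hz hy).trans ((Path.Homotopic.Quotient.refl w).cast rfl hw) =
        p.cast hz rfl := by
    intro x y z w p hz hy hw
    subst hz hy; simp
  rw [Path.Homotopic.Quotient.cast_cast]
  refine (hgen _ _ _ _).trans ?_
  exact Path.Homotopic.Quotient.cast_rfl_rfl _

end IsPrincipalBundle

/-! ### From a spinor structure to a splitting. -/

section SpinorToSplitting

open Set Topology Filter

variable {n k d d' : ℕ}
  {M : Type uM} [TopologicalSpace M] [ChartedSpace (EuclideanSpace ℝ (Fin n)) M]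
  {G : Type uG} [Group G] [TopologicalSpace G] [ChartedSpace (EuclideanSpace ℝ (Fin k)) G]
  {G' : Type uGt} [Group G'] [TopologicalSpace G'] [ChartedSpace (EuclideanSpace ℝ (Fin k)) G']
  {P : Type uP} [TopologicalSpace P] [ChartedSpace (EuclideanSpace ℝ (Fin d)) P]
  [MulAction Gᵐᵒᵖ P] {πP : P → M}
  {Q : Type*} [TopologicalSpace Q] [ChartedSpace (EuclideanSpace ℝ (Fin d')) Q]
  [MulAction G'ᵐᵒᵖ Q] {πQ : Q → M} {ρ : G' →* G} {u : Q → P}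

theorem MonoidHom.surjective_of_isOpenMap [IsTopologicalGroup G] [ConnectedSpace G]
    (hρ : IsOpenMap ρ) : Function.Surjective ρ := by
  have ho : IsOpen (ρ.range : Set G) := by
    rw [MonoidHom.coe_range]; exact hρ.isOpen_range
  have hc : IsClopen (ρ.range : Set G) := ⟨ρ.range.isClosed_of_isOpen ho, ho⟩
  rw [← range_eq_univ, ← MonoidHom.coe_range]
  exact hc.eq_univ ⟨1, ρ.range.one_mem⟩

/-- Near `u q` the map `u` has a continuous section `s` with `s (u q) = q`: for a local section `σ`
of `Q`, the element `H p` carries `u (σ (πP p))` to `p`, and a local inverse of `ρ` lifts it to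
`G'`. -/
theorem IsPrincipalBundle.isOpenMap_equivariant [IsTopologicalGroup G]
    (hP : IsPrincipalBundle n k d G πP) (hQ : IsPrincipalBundle n k d' G' πQ)
    (hρ : IsLocalHomeomorph ρ) (hu : Continuous u) (hproj : ∀ q, πP (u q) = πQ q)
    (heq : ∀ (q : Q) (g : G'), u (MulOpposite.op g • q) = MulOpposite.op (ρ g) • u q) :
    IsOpenMap u := by
  rw [isOpenMap_iff_nhds_le]
  intro q
  obtain ⟨eP, hmP, -, -, heP⟩ := hP.locally_trivial (πP (u q))
  obtain ⟨eQ, hmQ, -, -, heQ⟩ := hQ.locally_trivial (πQ q)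
  obtain ⟨f, hf, hρf⟩ := hρ (eQ q).2
  let σ : M → Q := fun m => eQ.toOpenPartialHomeomorph.symm (m, 1)
  have hπσ : ∀ m ∈ eQ.baseSet, πQ (σ m) = m := fun m hm => eQ.proj_symm_apply' hm
  let H : P → G := fun p => (eP (u (σ (πP p)))).2⁻¹ * (eP p).2
  let s : P → Q := fun p => MulOpposite.op (f.symm (H p)) • σ (πP p)
  have hq : MulOpposite.op (eQ q).2 • σ (πQ q) = q := by
    rw [← heQ _ hmQ]
    exact eQ.symm_apply_mk_proj (eQ.mem_source.2 hmQ)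
  have hHq : H (u q) = ρ (eQ q).2 := by
    have h1 : eP (u q) = (πP (u (σ (πQ q))), (eP (u (σ (πQ q)))).2 * ρ (eQ q).2) := by
      conv_lhs => rw [← hq, heq]
      refine IsPrincipalBundle.trivialization_smul heP ?_ _
      rw [hproj, hπσ _ hmQ, ← hproj]
      exact hmP
    change (eP (u (σ (πP (u q))))).2⁻¹ * (eP (u q)).2 = _
    rw [hproj, h1, inv_mul_cancel_left]
  have hmQ' : πP (u q) ∈ eQ.baseSet := by rw [hproj]; exact hmQ
  have hσc : ContinuousAt (fun p => σ (πP p)) (u q) := by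
    refine ContinuousAt.comp (g := σ) ?_ hP.smooth_proj.continuous.continuousAt
    exact eQ.continuousAt_symm_prodMk_left hmQ'
  have heσ : πP (u (σ (πP (u q)))) ∈ eP.baseSet := by
    rw [hproj, hπσ _ hmQ']; exact hmP
  have hHc : ContinuousAt H (u q) := by
    refine ContinuousAt.mul (ContinuousAt.inv ?_) ?_
    · refine continuousAt_snd.comp (ContinuousAt.comp (g := eP) ?_ (hu.continuousAt.comp hσc))
      exact eP.toOpenPartialHomeomorph.continuousAt (eP.mem_source.2 heσ)
    · exact continuousAt_snd.comp (eP.toOpenPartialHomeomorph.continuousAt (eP.mem_source.2 hmP))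
  have hft : H (u q) ∈ f.target := by
    rw [hHq, hρf]; exact f.map_source hf
  have hsc : ContinuousAt s (u q) := by
    refine hQ.continuous_smul.continuousAt.comp (f := fun p => (σ (πP p), f.symm (H p)))
      (hσc.prodMk ?_)
    exact ContinuousAt.comp (g := f.symm) (f.continuousAt_symm hft) hHc
  have hsq : s (u q) = q := by
    change MulOpposite.op (f.symm (H (u q))) • σ (πP (u q)) = q
    rw [hHq, hproj, hρf, f.left_inv hf, hq]
  have hus : ∀ᶠ p in 𝓝 (u q), u (s p) = p := by
    have hπ := hP.smooth_proj.continuous.continuousAt (x := u q)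
    filter_upwards [hHc.eventually (f.open_target.mem_nhds hft),
      hπ.eventually (eP.open_baseSet.mem_nhds hmP),
      hπ.eventually (eQ.open_baseSet.mem_nhds hmQ')] with p h1 h2 h3
    have h4 : πP (u (σ (πP p))) = πP p := by rw [hproj, hπσ _ h3]
    have h5 : u (s p) = MulOpposite.op (H p) • u (σ (πP p)) := by
      change u (MulOpposite.op (f.symm (H p)) • σ (πP p)) = _
      rw [heq, hρf, f.right_inv h1]
    have h6 : eP (u (s p)) = eP p := by
      rw [h5, IsPrincipalBundle.trivialization_smul heP (by rwa [h4]), h4, mul_inv_cancel_left]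
      exact eP.mk_proj_snd' h2
    refine eP.toOpenPartialHomeomorph.injOn (eP.mem_source.2 ?_) (eP.mem_source.2 h2) h6
    rw [h5, hP.proj_action, h4]
    exact h2
  calc 𝓝 (u q) = map (fun p => u (s p)) (𝓝 (u q)) := by
        rw [map_congr hus]; exact map_id.symm
    _ = map u (map s (𝓝 (u q))) := map_map.symm
    _ ≤ map u (𝓝 q) := map_mono (hsc.tendsto.mono_right (by rw [hsq]))

/-- The smooth map underlying a spinor structure is a covering map. -/
theorem IsPrincipalBundle.isCoveringMap_equivariant [IsTopologicalGroup G] [ConnectedSpace G]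
    (hP : IsPrincipalBundle n k d G πP) (hQ : IsPrincipalBundle n k d' G' πQ)
    (hρ : IsLocalHomeomorph ρ) (hu : Continuous u) (hproj : ∀ q, πP (u q) = πQ q)
    (heq : ∀ (q : Q) (g : G'), u (MulOpposite.op g • q) = MulOpposite.op (ρ g) • u q) :
    IsCoveringMap u ∧ Function.Surjective u := by
  have hρs : Function.Surjective ρ := MonoidHom.surjective_of_isOpenMap hρ.isOpenMap
  have hsurj : Function.Surjective u := by
    intro p
    obtain ⟨q, hq⟩ := hQ.surjective_proj (πP p)
    obtain ⟨g, hg⟩ := hP.transitive (u q) p (by rw [hproj, hq])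
    obtain ⟨g', rfl⟩ := hρs g
    exact ⟨MulOpposite.op g' • q, by rw [heq, hg]⟩
  -- The fibres of `u` are the orbits of `ker ρ`. The action is properly discontinuous: on points
  -- whose fibre coordinate lies where `ρ` is injective, an element of the kernel preserving that
  -- condition at some point must be 1.
  have hquot : IsQuotientCoveringMap u ρ.ker.op :=
    { toIsQuotientMap := (hP.isOpenMap_equivariant hQ hρ hu hproj heq).isQuotientMap hu hsurj
      continuous_const_smul := fun c =>
        hQ.continuous_smul.comp (f := fun q => (q, MulOpposite.unop c.1)) (by fun_prop)
      apply_eq_iff_mem_orbit := @fun q₁ q₂ => by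
        constructor
        · intro h
          obtain ⟨g, hg⟩ := hQ.transitive q₂ q₁ (by rw [← hproj, ← hproj, h])
          have h1 : MulOpposite.op (ρ g) • u q₂ = u q₂ := by rw [← heq, hg, h]
          exact ⟨⟨MulOpposite.op g, hP.free _ _ h1⟩, hg⟩
        · rintro ⟨⟨⟨g⟩, hg⟩, rfl⟩
          have hg' : ρ g = 1 := hg
          change u (MulOpposite.op g • q₂) = u q₂
          rw [heq, hg', MulOpposite.op_one, one_smul]
      disjoint := fun q => by
        obtain ⟨eQ, hmQ, -, -, heQ⟩ := hQ.locally_trivial (πQ q)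
        obtain ⟨f, hf, hρf⟩ := hρ (eQ q).2
        have hc : ContinuousAt (fun q => (eQ q).2) q :=
          continuousAt_snd.comp (eQ.toOpenPartialHomeomorph.continuousAt (eQ.mem_source.2 hmQ))
        refine ⟨{q' | πQ q' ∈ eQ.baseSet ∧ (eQ q').2 ∈ f.source}, ?_, ?_⟩
        · filter_upwards [hc.eventually (f.open_source.mem_nhds hf),
            hQ.smooth_proj.continuous.continuousAt.eventually (eQ.open_baseSet.mem_nhds hmQ)]
            with q' h1 h2 using ⟨h2, h1⟩
        · rintro ⟨⟨g⟩, hg⟩ ⟨_, ⟨q', hq', rfl⟩, hq''⟩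
          have hg' : ρ g = 1 := hg
          have h1 : eQ (MulOpposite.op g • q') = _ :=
            IsPrincipalBundle.trivialization_smul heQ hq'.1 g
          have h2 : (eQ q').2 * g ∈ f.source := by
            have := hq''.2
            change (eQ (MulOpposite.op g • q')).2 ∈ f.source at this
            rwa [h1] at this
          have h3 : (eQ q').2 * g = (eQ q').2 := by
            refine f.injOn h2 hq'.2 ?_
            rw [← hρf, map_mul, hg', mul_one]
          have h4 : g = 1 := mul_eq_left.1 h3
          subst h4
          rfl }
  exact ⟨hquot.isCoveringMap, hsurj⟩

/-- The monodromy of a loop in the structure group, viewed as a loop in a fibre. -/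
theorem IsPrincipalBundle.monodromy_orbitPi1 {G' : Type*} [Group G'] [TopologicalSpace G']
    [MulAction G'ᵐᵒᵖ Q] {ρ : G' →* G} (hP : IsPrincipalBundle n k d G πP)
    (hρ : IsCoveringMap ρ) (hact : ∀ q : Q, Continuous fun g : G' => MulOpposite.op g • q)
    (cov : IsCoveringMap u)
    (heq : ∀ (q : Q) (g : G'), u (MulOpposite.op g • q) = MulOpposite.op (ρ g) • u q)
    {p₀ : P} (q₀ : u ⁻¹' {p₀}) (a : FundamentalGroup G 1) :
    (cov.monodromy (hP.orbitPi1 p₀ a).toPath q₀ : Q) =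
      MulOpposite.op (hρ.monodromy a.toPath ⟨1, map_one ρ⟩ : G') • (q₀ : Q) := by
  obtain ⟨l, rfl⟩ := Path.Homotopic.Quotient.mk_surjective a
  obtain ⟨q₀, rfl⟩ := q₀
  -- By equivariance, `q₀` acted on by `L t` is the lift of the orbit loop starting at `q₀`.
  set L := hρ.liftPath l 1 (l.source.trans (map_one ρ).symm) with hL
  have hlift : ∀ t, ρ (L t) = l t := fun t => congrFun (hρ.liftPath_lifts ..) t
  have hL0 : L 0 = 1 := hρ.liftPath_zero ..
  have hL1 : ρ (L 1) = 1 := by rw [hlift, l.target]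
  have hend : u (MulOpposite.op (L 1) • q₀) = u q₀ := by
    rw [heq, hL1, MulOpposite.op_one, one_smul]
  refine congr_arg Subtype.val (cov.monodromy_eq_of_map_eq (ex := ⟨q₀, rfl⟩)
    (ey := ⟨MulOpposite.op (L 1) • q₀, hend⟩) (.mk
      { toFun := fun t => MulOpposite.op (L t) • q₀
        continuous_toFun := (hact q₀).comp L.continuous
        source' := by rw [hL0, MulOpposite.op_one, one_smul]
        target' := rfl }) ?_)
  have := hP.orbitPi1_mk (u q₀) l
  erw [this]
  refine congr_arg Path.Homotopic.Quotient.mk (Path.ext (funext fun t => ?_))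
  change u (MulOpposite.op (L t) • q₀) = MulOpposite.op (l t) • u q₀
  rw [heq, hlift]

/-- A class in the fundamental group of `G` with trivial monodromy on a simply connected cover is
trivial. -/
theorem eq_one_of_monodromy_eq_one [SimplyConnectedSpace G'] (hρ : IsCoveringMap ρ)
    {a : FundamentalGroup G 1} (ha : (hρ.monodromy a.toPath ⟨1, map_one ρ⟩ : G') = 1) : a = 1 := by
  have h1 := hρ.map_liftPathQuotient a.toPath ⟨1, map_one ρ⟩
  -- The endpoint is generalised so that it can be replaced by 1; the lift is then a loop in a
  -- simply connected space.
  have h2 : ∀ (z : G') (hz : z = 1) (c : Path.Homotopic.Quotient (1 : G') z) (hz' : ρ z = 1),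
      c.map ⟨ρ, hρ.continuous⟩ = a.toPath.cast (map_one ρ) hz' → a = 1 := by
    rintro _ rfl c hz' hc
    rw [Subsingleton.elim c (.refl 1)] at hc
    have h3 : a.toPath = ((Path.Homotopic.Quotient.refl (1 : G')).map ⟨ρ, hρ.continuous⟩).cast
        (map_one ρ).symm (map_one ρ).symm := by
      rw [hc, Path.Homotopic.Quotient.cast_cast, Path.Homotopic.Quotient.cast_rfl_rfl]
    refine h3.trans ?_
    refine congr_arg Path.Homotopic.Quotient.mk (Path.ext (funext fun t => ?_))
    exact map_one ρ
  exact h2 _ ha _ (hρ.monodromy a.toPath ⟨1, map_one ρ⟩).2 h1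

/-- The image under `ρ` of a path from 1 to `g` is a loop with the required lift. -/
theorem exists_monodromy_eq [PathConnectedSpace G'] (hρ : IsCoveringMap ρ) {g : G'}
    (hg : ρ g = 1) : ∃ a : FundamentalGroup G 1,
      (hρ.monodromy a.toPath ⟨1, map_one ρ⟩ : G') = g := by
  let γ : Path.Homotopic.Quotient (1 : G') g := .mk (PathConnectedSpace.somePath 1 g)
  let a : Path.Homotopic.Quotient (1 : G) 1 :=
    (γ.map ⟨ρ, hρ.continuous⟩).cast (map_one ρ).symm hg.symm
  refine ⟨a, congr_arg Subtype.val (hρ.monodromy_eq_of_map_eq (γ := a) (ex := ⟨1, map_one ρ⟩)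
    (ey := ⟨g, hg⟩) γ ?_)⟩
  exact ((Path.Homotopic.Quotient.cast_cast _ _ _ _ _).trans
    (Path.Homotopic.Quotient.cast_rfl_rfl _)).symm

end SpinorToSplitting

/-- A spinor structure splits the fundamental group of the total space. -/
theorem SpinorStructure.exists_splitting {n k d : ℕ}
    {M : Type uM} [TopologicalSpace M] [ChartedSpace (EuclideanSpace ℝ (Fin n)) M]
    [ConnectedSpace M]
    {G : Type uG} [Group G] [TopologicalSpace G] [ChartedSpace (EuclideanSpace ℝ (Fin k)) G]
    [IsTopologicalGroup G] [ConnectedSpace G]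
    {G' : Type uGt} [Group G'] [TopologicalSpace G'] [ChartedSpace (EuclideanSpace ℝ (Fin k)) G']
    {ρ : G' →* G} (hρ : IsUniversalCoveringGroup k ρ)
    {P : Type uP} [TopologicalSpace P] [ChartedSpace (EuclideanSpace ℝ (Fin d)) P]
    [MulAction Gᵐᵒᵖ P]
    {πP : P → M} (hP : IsPrincipalBundle n k d G πP) (p₀ : P)
    (S : SpinorStructure n k d ρ πP) :
      ∃ K I : Subgroup (FundamentalGroup P p₀),
        IsInternalDirectProduct K I ∧
        Set.BijOn (hP.projPi1 p₀) (K : Set (FundamentalGroup P p₀)) Set.univ ∧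
        Set.BijOn (hP.orbitPi1 p₀) Set.univ (I : Set (FundamentalGroup P p₀)) := by
  let := S.topologicalSpace
  let := S.chartedSpace
  let := S.mulAction
  have := hρ.simplyConnected
  have hQ := S.isPrincipalBundle
  have hρc := hρ.isCoveringMap
  obtain ⟨cov, hsurj⟩ := hP.isCoveringMap_equivariant hQ hρc.isLocalHomeomorph
    S.smooth_u.continuous S.proj_u S.equivariant_u
  obtain ⟨q₀, hq₀⟩ := hsurj p₀
  let x₀ : S.u ⁻¹' {p₀} := ⟨q₀, hq₀⟩
  have hmon : ∀ a : FundamentalGroup G 1,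
      (cov.monodromy (hP.orbitPi1 p₀ a).toPath x₀ : S.Q) =
        MulOpposite.op (hρc.monodromy a.toPath ⟨1, map_one ρ⟩ : G') • q₀ :=
    hP.monodromy_orbitPi1 hρc (fun q => hQ.continuous_smul.comp (Continuous.prodMk_right q)) cov
      S.equivariant_u x₀
  have htriv : ∀ a, cov.monodromy (hP.orbitPi1 p₀ a).toPath x₀ = x₀ → a = 1 := by
    intro a ha
    refine eq_one_of_monodromy_eq_one hρc (hQ.free q₀ _ ?_)
    rw [← hmon, ha]
  let act := cov.fundamentalGroupMulAction p₀
  have hsmul : ∀ (a : FundamentalGroup P p₀) (x : S.u ⁻¹' {p₀}),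
      a • x = cov.monodromy a.toPath x := fun _ _ => rfl
  let K := MulAction.stabilizer (FundamentalGroup P p₀) x₀
  let I := (hP.orbitPi1 p₀).range
  have hinf : K ⊓ I = ⊥ := by
    rw [eq_bot_iff]
    rintro _ ⟨hK, ⟨a, rfl⟩⟩
    rw [htriv a hK, map_one]
    exact Subgroup.one_mem _
  -- `I` is already transitive on the fibre: `a` moves `q₀` by an element of `ker ρ`, which some
  -- loop in `G` realises as monodromy.
  have hdecomp : ∀ a : FundamentalGroup P p₀, ∃ x ∈ K, ∃ b, a = hP.orbitPi1 p₀ b * x := by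
    intro a
    obtain ⟨g, hg⟩ := hQ.transitive q₀ (a • x₀ : S.u ⁻¹' {p₀}).1
      (by rw [← S.proj_u, ← S.proj_u, hq₀, (a • x₀).2])
    have hρg : ρ g = 1 := by
      refine hP.free p₀ _ ?_
      have h1 := S.equivariant_u q₀ g
      rw [hg, hq₀] at h1
      rw [← h1]
      exact (a • x₀).2
    obtain ⟨b, hb⟩ := exists_monodromy_eq hρc hρg
    have h2 : hP.orbitPi1 p₀ b • x₀ = a • x₀ := Subtype.ext <| by
      rw [hsmul, hmon, hb, hg]
    refine ⟨(hP.orbitPi1 p₀ b)⁻¹ * a, ?_, b, by group⟩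
    change ((hP.orbitPi1 p₀ b)⁻¹ * a) • x₀ = x₀
    rw [mul_smul, ← h2, inv_smul_smul]
  refine ⟨K, I, ⟨?_, hinf, ?_⟩, ⟨fun _ _ => Set.mem_univ _, ?_, ?_⟩,
    ⟨fun a _ => ⟨a, rfl⟩, ?_, ?_⟩⟩
  · rintro x - _ ⟨b, rfl⟩
    exact hP.orbitPi1_comm p₀ x b
  · refine (Subgroup.eq_top_iff' _).2 fun a => ?_
    obtain ⟨x, hx, b, rfl⟩ := hdecomp a
    exact Subgroup.mul_mem _ (Subgroup.mem_sup_right ⟨b, rfl⟩) (Subgroup.mem_sup_left hx)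
  -- By exactness `x⁻¹ * y` lies in `I`, and `K` meets `I` trivially.
  · intro x hx y hy hxy
    have h1 : x⁻¹ * y ∈ I := hP.mem_range_orbitPi1 p₀ (by rw [map_mul, map_inv, hxy]; group)
    have h2 : x⁻¹ * y ∈ K ⊓ I := ⟨K.mul_mem (K.inv_mem hx) hy, h1⟩
    rw [hinf] at h2
    exact inv_mul_eq_one.1 (Subgroup.mem_bot.1 h2)
  · intro b _
    obtain ⟨a, rfl⟩ := hP.surjective_projPi1 p₀ b
    obtain ⟨x, hx, c, rfl⟩ := hdecomp a
    exact ⟨x, hx, by rw [map_mul, hP.projPi1_orbitPi1, one_mul]⟩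
  · intro a _ b _ hab
    have h1 : hP.orbitPi1 p₀ (a⁻¹ * b) = 1 := by rw [map_mul, map_inv, hab]; group
    refine inv_mul_eq_one.1 (htriv _ ?_)
    rw [h1]
    exact congrFun cov.monodromy_refl x₀
  · rintro _ ⟨a, rfl⟩
    exact ⟨a, Set.mem_univ _, rfl⟩

/-! ### Lifting a group action to a covering. -/

section LiftedAction

open Set Topology Filter

/-- A right action of a simply connected group lifts to covering spaces. -/
theorem IsCoveringMap.exists_lift_action {P Q G' : Type*} [TopologicalSpace P]
    [TopologicalSpace Q] [Group G'] [TopologicalSpace G'] [IsTopologicalGroup G']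
    [SimplyConnectedSpace G'] [LocallyPathConnectedSpace G'] {u : Q → P} (cov : IsCoveringMap u)
    (r : P → G' → P) (hr : Continuous fun x : P × G' => r x.1 x.2) (hone : ∀ p, r p 1 = p)
    (hmul : ∀ p g g', r (r p g) g' = r p (g * g')) :
    ∃ s : Q → G' → Q, (∀ q g, u (s q g) = r (u q) g) ∧ (∀ q, s q 1 = q) ∧
      (∀ q g g', s (s q g) g' = s q (g * g')) ∧ Continuous fun x : Q × G' => s x.1 x.2 := by
  -- Each orbit map lifts because `G'` is simply connected; uniqueness of lifts then gives the
  -- action law.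
  have hex : ∀ q, ∃ F : C(G', Q), F 1 = q ∧ ∀ g, u (F g) = r (u q) g := by
    intro q
    obtain ⟨F, ⟨h1, h2⟩, -⟩ := cov.existsUnique_continuousMap_lifts
      (⟨fun g => r (u q) g, hr.comp (Continuous.prodMk_right (u q))⟩ : C(G', P)) 1 q (hone _).symm
    exact ⟨F, h1, fun g => congrFun h2 g⟩
  choose s hs1 hsu using hex
  have hsmul : ∀ q g g', s (s q g) g' = s q (g * g') := by
    intro q g g'
    refine congrFun (cov.eq_of_comp_eq (g₁ := s (s q g)) (g₂ := fun g' => s q (g * g'))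
      (s (s q g)).continuous ((s q).continuous.comp (continuous_const_mul g)) ?_ 1 ?_) g'
    · funext g'
      simp only [Function.comp_apply, hsu, hmul]
    · simp only [hs1, mul_one]
  -- Along a path from 1 to `g` this is a homotopy lift starting at the identity of `Q`.
  have hsc : ∀ g, Continuous fun q => s q g := by
    intro g
    let γ : Path (1 : G') g := PathConnectedSpace.somePath 1 g
    have h := cov.isLocalHomeomorph.continuous_lift cov.isSeparatedMap
      (A := Q) (f := ⟨fun x => r (u x.2) (γ x.1), hr.comp
        ((cov.continuous.comp continuous_snd).prodMk (γ.continuous.comp continuous_fst))⟩)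
      (g := fun x => s x.2 (γ x.1)) (funext fun x => hsu _ _)
      (by simpa only [γ.source, hs1] using continuous_id')
      (fun q => (s q).continuous.comp γ.continuous)
    simpa only [Function.comp_def, γ.target] using
      h.comp (Continuous.prodMk_right (1 : unitInterval))
  refine ⟨fun q => s q, hsu, hs1, hsmul, ?_⟩
  rw [continuous_iff_continuousAt]
  rintro ⟨q₁, g₁⟩
  obtain ⟨f, hf, huf⟩ := cov.isLocalHomeomorph (s q₁ g₁)
  let w : Q × G' → P := fun x => r (u x.1) x.2
  have hw : Continuous w :=
    hr.comp ((cov.continuous.comp continuous_fst).prodMk continuous_snd)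
  have hwt : w (q₁, g₁) ∈ f.target := by
    change r (u q₁) g₁ ∈ f.target
    rw [← hsu, huf]; exact f.map_source hf
  -- For `q` near `q₁` both sides lift the same map on a path-connected neighbourhood of `g₁`, and
  -- they agree at `g₁` by continuity in `q`.
  have hev : ∀ᶠ x in 𝓝 (q₁, g₁), f.symm (w x) = s x.1 x.2 := by
    obtain ⟨W, hW, N, hN, hWN⟩ := mem_nhds_prod_iff.1
      ((f.open_target.preimage hw).mem_nhds hwt)
    obtain ⟨N', ⟨hN', hN'c⟩, hN'N⟩ := (path_connected_basis g₁).mem_iff.1 hN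
    have hW' : {q | s q g₁ ∈ f.source} ∈ 𝓝 q₁ :=
      (f.open_source.preimage (hsc g₁)).mem_nhds hf
    filter_upwards [prod_mem_nhds (inter_mem hW hW') hN'] with ⟨q, g⟩ ⟨⟨hqW, hqs⟩, hg⟩
    have hmem : ∀ z ∈ N', w (q, z) ∈ f.target := fun z hz => hWN ⟨hqW, hN'N hz⟩
    refine cov.eqOn_of_comp_eqOn (g₁ := fun z => f.symm (w (q, z))) (g₂ := fun z => s q z)
      hN'c.isConnected.isPreconnected ?_ (s q).continuous.continuousOn ?_ (mem_of_mem_nhds hN') ?_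
      hg
    · exact f.continuousOn_symm.comp (hw.comp (Continuous.prodMk_right q)).continuousOn hmem
    · intro z hz
      simp only [Function.comp_apply, hsu]
      rw [huf, f.right_inv (hmem z hz), ← huf]
    · change f.symm (r (u q) g₁) = s q g₁
      rw [← hsu, huf, f.left_inv hqs]
  exact ((f.continuousAt_symm hwt).comp hw.continuousAt).congr hev

end LiftedAction

/-! ### The covering as a smooth principal bundle. -/

section CoverBundle

open Set Topology Filter

variable {n k d : ℕ}
  {M : Type uM} [TopologicalSpace M] [ChartedSpace (EuclideanSpace ℝ (Fin n)) M]
  {G : Type uG} [Group G] [TopologicalSpace G] [ChartedSpace (EuclideanSpace ℝ (Fin k)) G]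
  {G' : Type uGt} [Group G'] [TopologicalSpace G'] [ChartedSpace (EuclideanSpace ℝ (Fin k)) G']
  {P : Type uP} [TopologicalSpace P] [ChartedSpace (EuclideanSpace ℝ (Fin d)) P]
  [MulAction Gᵐᵒᵖ P] {πP : P → M}
  {Q : Type*} [TopologicalSpace Q] [MulAction G'ᵐᵒᵖ Q] {ρ : G' →* G} {u : Q → P}

/-- Countably many trivialisations cover `P`. Applied to the covering `Q`, this yields its
paracompactness. -/
theorem IsPrincipalBundle.secondCountableTopology (hP : IsPrincipalBundle n k d G πP)
    [SecondCountableTopology M] [SecondCountableTopology G] : SecondCountableTopology P := by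
  choose e he _ _ _ using hP.locally_trivial
  obtain ⟨c, hc, hcu⟩ := TopologicalSpace.countable_cover_nhds
    (fun m => (e m).open_baseSet.mem_nhds (he m))
  have := hc.to_subtype
  have (m : c) : SecondCountableTopology (e m).source :=
    (e m).toOpenPartialHomeomorph.toHomeomorphSourceTarget.secondCountableTopology
  refine TopologicalSpace.secondCountableTopology_of_countable_cover
    (U := fun m : c => (e m).source) (fun m => (e m).open_source) ?_
  refine eq_univ_of_forall fun p => ?_
  have : πP p ∈ ⋃ x ∈ c, (e x).baseSet := hcu ▸ mem_univ _
  obtain ⟨m, hm, hpm⟩ := mem_iUnion₂.1 this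
  exact mem_iUnion.2 ⟨⟨m, hm⟩, (e m).mem_source.2 hpm⟩

/-- A local trivialisation of a principal bundle, lifted to a covering on which the covering
group acts simply transitively over the action of the structure group. -/
theorem IsPrincipalBundle.exists_trivialization_cover (hP : IsPrincipalBundle n k d G πP)
    (hu : IsLocalHomeomorph u) (hsurj : Function.Surjective u)
    (hρ : IsLocalDiffeomorph (𝓡 k) (𝓡 k) ∞ ρ)
    (hact : Continuous fun x : Q × G' => MulOpposite.op x.2 • x.1)
    (heq : ∀ (q : Q) (g : G'), u (MulOpposite.op g • q) = MulOpposite.op (ρ g) • u q)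
    (hfree : ∀ (q : Q) (g : G'), MulOpposite.op g • q = q → g = 1)
    (htrans : ∀ q q' : Q, πP (u q) = πP (u q') → ∃ g : G', MulOpposite.op g • q = q') (m₀ : M) :
    letI := hu.pullbackChartedSpace (d := d)
    ∃ e : Bundle.Trivialization G' (πP ∘ u), m₀ ∈ e.baseSet ∧
    ContMDiffOn (𝓡 d) ((𝓡 n).prod (𝓡 k)) ∞ e.toOpenPartialHomeomorph e.source ∧
    ContMDiffOn ((𝓡 n).prod (𝓡 k)) (𝓡 d) ∞ e.toOpenPartialHomeomorph.symm e.target ∧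
    ∀ m ∈ e.baseSet, ∀ g : G', e.toOpenPartialHomeomorph.symm (m, g) =
      MulOpposite.op g • e.toOpenPartialHomeomorph.symm (m, (1 : G')) := by
  let := hu.pullbackChartedSpace (d := d)
  obtain ⟨e, hm₀, hes, hesymm, he⟩ := hP.locally_trivial m₀
  let σ : M → P := fun m => e.toOpenPartialHomeomorph.symm (m, 1)
  have hσs : ∀ m ∈ e.baseSet, ContMDiffAt (𝓡 n) (𝓡 d) ∞ σ m := fun m hm =>
    (hesymm.contMDiffAt (e.open_target.mem_nhds (e.mem_target.2 hm))).comp m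
      (contMDiffAt_id.prodMk contMDiffAt_const)
  have hσc : ContinuousOn σ e.baseSet := fun m hm =>
    (hσs m hm).continuousAt.continuousWithinAt
  obtain ⟨q₁, hq₁⟩ := hsurj (σ m₀)
  obtain ⟨f, hf, huf⟩ := hu q₁
  let U : Set M := e.baseSet ∩ σ ⁻¹' f.target
  have hUo : IsOpen U := hσc.isOpen_inter_preimage e.open_baseSet f.open_target
  have hm₀U : m₀ ∈ U := ⟨hm₀, by
    rw [mem_preimage, ← hq₁, huf]; exact f.map_source hf⟩
  let τ : M → Q := fun m => f.symm (σ m)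
  have huτ : ∀ m ∈ U, u (τ m) = σ m := fun m hm => by rw [huf]; exact f.right_inv hm.2
  have hπτ : ∀ m ∈ U, πP (u (τ m)) = m := fun m hm => by
    rw [huτ m hm]; exact e.proj_symm_apply' hm.1
  have hτc : ∀ m ∈ U, ContinuousAt τ m := fun m hm =>
    (f.continuousAt_symm hm.2).comp (hσs m hm.1).continuousAt
  have hus : ContMDiff (𝓡 d) (𝓡 d) ∞ u := hu.contMDiff_pullback
  have hπs : ContMDiff (𝓡 d) (𝓡 n) ∞ (πP ∘ u) := hP.smooth_proj.comp hus
  have hex : ∀ q, ∃ g : G', πP (u q) ∈ U → MulOpposite.op g • τ (πP (u q)) = q := by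
    intro q
    by_cases hq : πP (u q) ∈ U
    · obtain ⟨g, hg⟩ := htrans (τ (πP (u q))) q (hπτ _ hq)
      exact ⟨g, fun _ => hg⟩
    · exact ⟨1, fun h => (hq h).elim⟩
  -- `c q` is the group coordinate of `q` relative to the local section `τ`, unique by freeness.
  choose c hc using hex
  have hcu : ∀ q, ∀ g, πP (u q) ∈ U → MulOpposite.op g • τ (πP (u q)) = q → c q = g := by
    intro q g hq hg
    have h1 : MulOpposite.op (c q * g⁻¹) • τ (πP (u q)) = τ (πP (u q)) := by
      rw [MulOpposite.op_mul, mul_smul, hc q hq, MulOpposite.op_inv, inv_smul_eq_iff, hg]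
    exact mul_inv_eq_one.1 (hfree _ _ h1)
  have hρc : ∀ q, πP (u q) ∈ U → (e (u q)).2 = ρ (c q) := by
    intro q hq
    have h1 : u q = MulOpposite.op (ρ (c q)) • σ (πP (u q)) := by
      conv_lhs => rw [← hc q hq, heq, huτ _ hq]
    have h2 : u q = e.toOpenPartialHomeomorph.symm (πP (u q), ρ (c q)) := by
      rw [he _ hq.1]; exact h1
    rw [h2, e.apply_symm_apply' hq.1]
  have hVo : IsOpen ((πP ∘ u) ⁻¹' U) := hUo.preimage hπs.continuous
  have hcs : ∀ q, πP (u q) ∈ U → ContMDiffAt (𝓡 d) (𝓡 k) ∞ c q := by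
    intro q hq
    obtain ⟨Φ, hΦ, hρΦ⟩ := hρ (c q)
    -- Since `ρ ∘ c` is the smooth fibre coordinate of `u`, `c'` is a smooth candidate for `c`. They
    -- agree near `q`: `τ` moved by `c' z` lies over the same point of `P` as `z` and, by
    -- continuity, in the same sheet `f'`.
    let c' : Q → G' := fun z => Φ.symm (e (u z)).2
    have hΦt : (e (u q)).2 ∈ Φ.target := by
      rw [hρc q hq, hρΦ hΦ]; exact Φ.map_source hΦ
    have hes' : ContMDiffAt (𝓡 d) (𝓡 k) ∞ (fun z => (e (u z)).2) q :=
      contMDiffAt_snd.comp q ((hes.contMDiffAt (e.open_source.mem_nhds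
        (e.mem_source.2 hq.1))).comp q (hus q))
    have hc's : ContMDiffAt (𝓡 d) (𝓡 k) ∞ c' q :=
      ContMDiffAt.comp q (g := Φ.symm)
        (Φ.contMDiffOn_invFun.contMDiffAt (Φ.open_target.mem_nhds hΦt)) hes'
    have hc'q : c' q = c q := by
      change Φ.symm (e (u q)).2 = c q
      rw [hρc q hq, hρΦ hΦ]
      exact Φ.left_inv hΦ
    refine hc's.congr_of_eventuallyEq ?_
    let w : Q → Q := fun z => MulOpposite.op (c' z) • τ (πP (u z))
    have hwc : ContinuousAt w q :=
      hact.continuousAt.comp (f := fun z => (τ (πP (u z)), c' z))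
        ((ContinuousAt.comp (g := τ) (f := πP ∘ u) (hτc _ hq) hπs.continuous.continuousAt).prodMk
          hc's.continuousAt)
    have hwq : w q = q := by
      change MulOpposite.op (c' q) • τ (πP (u q)) = q
      rw [hc'q, hc q hq]
    obtain ⟨f', hf', huf'⟩ := hu q
    filter_upwards [hVo.mem_nhds hq, f'.open_source.mem_nhds hf',
      hwc.eventually (by rw [hwq]; exact f'.open_source.mem_nhds hf'),
      hes'.continuousAt.eventually (Φ.open_target.mem_nhds hΦt)] with z h1 h2 h3 h4
    replace h1 : πP (u z) ∈ U := h1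
    refine hcu z (c' z) h1 (f'.injOn h3 h2 ?_)
    rw [← huf']
    change u (MulOpposite.op (c' z) • τ (πP (u z))) = u z
    have h5 : ρ (c' z) = (e (u z)).2 :=
      (hρΦ (Φ.map_target h4)).trans (Φ.right_inv h4)
    rw [heq, huτ _ h1, h5]
    change _ • e.toOpenPartialHomeomorph.symm _ = _
    rw [← he _ h1.1]
    exact e.symm_apply_mk_proj (e.mem_source.2 h1.1)
  have hinv : ∀ x : M × G', x.1 ∈ U →
      ContMDiffAt ((𝓡 n).prod (𝓡 k)) (𝓡 d) ∞ (fun x : M × G' => MulOpposite.op x.2 • τ x.1) x := by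
    intro x hx
    refine hu.contMDiffAt_pullback_iff.2 ⟨?_, ?_⟩
    · exact hact.continuousAt.comp (f := fun x : M × G' => (τ x.1, x.2))
        ((ContinuousAt.comp (g := τ) (hτc _ hx) continuousAt_fst).prodMk continuousAt_snd)
    · have h1 : ContMDiffAt ((𝓡 n).prod (𝓡 k)) (𝓡 d) ∞
          (fun x : M × G' => MulOpposite.op (ρ x.2) • σ x.1) x :=
        ContMDiffAt.comp x (g := fun y : P × G => MulOpposite.op y.2 • y.1)
          (f := fun x : M × G' => (σ x.1, ρ x.2)) (hP.smooth_action _)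
          (((hσs x.1 hx.1).comp x contMDiffAt_fst).prodMk
            ((hρ.contMDiff x.2).comp x contMDiffAt_snd))
      refine h1.congr_of_eventuallyEq ?_
      filter_upwards [continuousAt_fst.eventually (hUo.mem_nhds hx)] with y hy
      simp only [Function.comp_apply, heq]
      rw [huτ _ hy]
  have hproj : ∀ m ∈ U, ∀ g : G', πP (u (MulOpposite.op g • τ m)) = m := fun m hm g => by
    rw [heq, hP.proj_action, hπτ m hm]
  let T : Bundle.Trivialization G' (πP ∘ u) :=
    { toFun := fun q => (πP (u q), c q)
      invFun := fun x => MulOpposite.op x.2 • τ x.1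
      source := (πP ∘ u) ⁻¹' U
      target := U ×ˢ univ
      map_source' := fun q hq => ⟨hq, mem_univ _⟩
      map_target' := fun x hx => by
        change πP (u _) ∈ U
        rw [hproj _ hx.1]; exact hx.1
      left_inv' := fun q hq => hc q hq
      right_inv' := fun x hx => by
        have h1 := hproj x.1 hx.1 x.2
        refine Prod.ext h1 (hcu _ _ ?_ ?_)
        · rw [h1]; exact hx.1
        · rw [h1]
      open_source := hVo
      open_target := hUo.prod isOpen_univ
      continuousOn_toFun := fun q hq =>
        (hπs.continuous.continuousAt.prodMk (hcs q hq).continuousAt).continuousWithinAt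
      continuousOn_invFun := fun x hx => (hinv x hx.1).continuousAt.continuousWithinAt
      baseSet := U
      open_baseSet := hUo
      source_eq := rfl
      target_eq := rfl
      proj_toFun := fun q hq => rfl }
  refine ⟨T, hm₀U, fun q hq => ?_, fun x hx => ?_, fun m hm g => ?_⟩
  · exact ((hπs q).prodMk (hcs q hq)).contMDiffWithinAt
  · exact (hinv x hx.1).contMDiffWithinAt
  · change MulOpposite.op g • τ m = MulOpposite.op g • MulOpposite.op (1 : G') • τ m
    rw [MulOpposite.op_one, one_smul]

theorem IsPrincipalBundle.isPrincipalBundle_cover (hP : IsPrincipalBundle n k d G πP)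
    (hu : IsLocalHomeomorph u) (hsurj : Function.Surjective u)
    (hρ : IsLocalDiffeomorph (𝓡 k) (𝓡 k) ∞ ρ)
    (hact : Continuous fun x : Q × G' => MulOpposite.op x.2 • x.1)
    (heq : ∀ (q : Q) (g : G'), u (MulOpposite.op g • q) = MulOpposite.op (ρ g) • u q)
    (hfree : ∀ (q : Q) (g : G'), MulOpposite.op g • q = q → g = 1)
    (htrans : ∀ q q' : Q, πP (u q) = πP (u q') → ∃ g : G', MulOpposite.op g • q = q') :
    letI := hu.pullbackChartedSpace (d := d)
    IsPrincipalBundle n k d G' (πP ∘ u) := by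
  let := hu.pullbackChartedSpace (d := d)
  have hus : ContMDiff (𝓡 d) (𝓡 d) ∞ u := hu.contMDiff_pullback
  exact
    { smooth_proj := hP.smooth_proj.comp hus
      surjective_proj := hP.surjective_proj.comp hsurj
      smooth_action := fun x => by
        refine hu.contMDiffAt_pullback_iff.2 ⟨hact.continuousAt, ?_⟩
        have h1 : ContMDiffAt ((𝓡 d).prod (𝓡 k)) (𝓡 d) ∞
            (fun x : Q × G' => MulOpposite.op (ρ x.2) • u x.1) x :=
          ContMDiffAt.comp x (g := fun y : P × G => MulOpposite.op y.2 • y.1)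
            (f := fun x : Q × G' => (u x.1, ρ x.2)) (hP.smooth_action _)
            (((hus x.1).comp x contMDiffAt_fst).prodMk
              ((hρ.contMDiff x.2).comp x contMDiffAt_snd))
        exact h1.congr_of_eventuallyEq (Eventually.of_forall fun y => heq y.1 y.2)
      proj_action := fun q g => by
        simp only [Function.comp_apply, heq, hP.proj_action]
      transitive := htrans
      free := hfree
      locally_trivial := hP.exists_trivialization_cover hu hsurj hρ hact heq hfree htrans }

end CoverBundle

/-! ### From a splitting to a spinor structure. -/

section SplittingToSpinor

open Set Topology Filter

/-- A deck map sends lifts of a path to lifts of the same path. -/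
theorem IsCoveringMap.monodromy_comp_deck {P Q : Type*} [TopologicalSpace P] [TopologicalSpace Q]
    {u : Q → P} (cov : IsCoveringMap u) (s : C(Q, Q)) (hs : ∀ q, u (s q) = u q) {p p' : P}
    (γ : Path.Homotopic.Quotient p p') (x : u ⁻¹' {p}) :
    (cov.monodromy γ ⟨s x, (hs x).trans x.2⟩ : Q) = s (cov.monodromy γ x) := by
  obtain ⟨γ, rfl⟩ := Path.Homotopic.Quotient.mk_surjective γ
  set L := cov.liftPath γ x (γ.source.trans x.2.symm) with hL
  have hlift : ∀ t, u (L t) = γ t := fun t => congrFun (cov.liftPath_lifts ..) t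
  have hL0 : L 0 = x := cov.liftPath_zero ..
  refine congr_arg Subtype.val (cov.monodromy_eq_of_map_eq (γ := .mk γ)
    (ex := ⟨s x, (hs x).trans x.2⟩)
    (ey := ⟨s (L 1), (hs _).trans ((hlift 1).trans γ.target)⟩) (.mk
      { toFun := fun t => s (L t)
        continuous_toFun := s.continuous.comp L.continuous
        source' := by rw [hL0]
        target' := rfl }) ?_)
  refine congr_arg Path.Homotopic.Quotient.mk (Path.ext (funext fun t => ?_))
  exact (hs _).trans (hlift t)

/-- A homomorphism on the fundamental group of a manifold is the monodromy of a covering. -/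
theorem exists_isCoveringMap_of_chartedSpace {d : ℕ} {P : Type uP} {A : Type uG}
    [TopologicalSpace P] [ChartedSpace (EuclideanSpace ℝ (Fin d)) P] [PathConnectedSpace P]
    [Group A] (p₀ : P) (φ : FundamentalGroup P p₀ →* A) :
    ∃ (E : Type max uP uG) (_ : TopologicalSpace E) (u : E → P) (cov : IsCoveringMap u)
      (θ : u ⁻¹' {p₀} ≃ A), Function.Surjective u ∧
      ∀ (δ : FundamentalGroup P p₀) (e : u ⁻¹' {p₀}),
        θ (cov.monodromy δ.toPath e) = φ δ * θ e := by
  obtain ⟨E, tE, u, cov, θ, hu, hθ⟩ := exists_isCoveringMap_monodromy (ContinuousMap.id P)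
    Function.surjective_id (fun y y' h => by
      obtain rfl : y = y' := h
      exact JoinedIn.refl rfl) p₀ φ (fun x U hU => by
      obtain ⟨V, hVU, hVo, hxV, hVs⟩ :=
        exists_isSimplyConnected_nhds (E := EuclideanSpace ℝ (Fin d)) x hU
      refine ⟨V, hVU, hVo, hxV, hVs.isPathConnected, fun y p γ hp => ?_⟩
      obtain ⟨H, -⟩ := (isSimplyConnected_iff_exists_homotopy_refl_forall_mem.1 hVs).2 y p hp
      have hp1 : Path.Homotopic.Quotient.mk p = .refl y := Path.Homotopic.Quotient.eq.2 ⟨H⟩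
      rw [Path.Homotopic.Quotient.mk_trans, Path.Homotopic.Quotient.mk_trans, hp1,
        Path.Homotopic.Quotient.refl_trans, Path.Homotopic.Quotient.mk_symm,
        Path.Homotopic.Quotient.trans_symm]
      exact map_one φ)
  refine ⟨E, tE, u, cov, θ, hu, fun δ e => ?_⟩
  refine Eq.trans ?_ (hθ δ e)
  obtain ⟨δ, rfl⟩ := Path.Homotopic.Quotient.mk_surjective δ
  rfl

/-- The normaliser of `K` contains `K` and, since `L` centralises `K`, also `L`. -/
theorem IsInternalDirectProduct.normal {Γ : Type*} [Group Γ] {K L : Subgroup Γ}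
    (h : IsInternalDirectProduct K L) : K.Normal := by
  rw [← Subgroup.normalizer_eq_top_iff, eq_top_iff, ← h.sup_eq_top, sup_le_iff]
  refine ⟨Subgroup.le_normalizer, fun y hy => Subgroup.mem_normalizer_iff.2 fun x => ?_⟩
  have key : ∀ z ∈ L, ∀ x ∈ K, z * x * z⁻¹ = x := fun z hz x hx => by
    rw [← h.commute x hx z hz, mul_inv_cancel_right]
  constructor
  · intro hx
    rwa [key y hy x hx]
  · intro hx
    have h1 := key y⁻¹ (L.inv_mem hy) _ hx
    have h2 : y⁻¹ * (y * x * y⁻¹) * y⁻¹⁻¹ = x := by group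
    rw [h2] at h1
    rwa [h1]

theorem IsPrincipalBundle.nonempty_spinorStructure {n k d : ℕ}
    {M : Type uM} [TopologicalSpace M] [ChartedSpace (EuclideanSpace ℝ (Fin n)) M]
    [T2Space M] [ParacompactSpace M] [ConnectedSpace M]
    {G : Type uG} [Group G] [TopologicalSpace G] [ChartedSpace (EuclideanSpace ℝ (Fin k)) G]
    [IsTopologicalGroup G] [ConnectedSpace G]
    {G' : Type uGt} [Group G'] [TopologicalSpace G'] [ChartedSpace (EuclideanSpace ℝ (Fin k)) G']
    [IsTopologicalGroup G'] [T2Space G'] [ParacompactSpace G']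
    {ρ : G' →* G} (hρ : IsUniversalCoveringGroup k ρ)
    {P : Type uP} [TopologicalSpace P] [ChartedSpace (EuclideanSpace ℝ (Fin d)) P]
    [IsManifold (𝓡 d) ∞ P] [T2Space P] [MulAction Gᵐᵒᵖ P]
    {πP : P → M} (hP : IsPrincipalBundle n k d G πP) (p₀ : P)
    {K I : Subgroup (FundamentalGroup P p₀)} (hKI : IsInternalDirectProduct K I)
    (hI : Set.BijOn (hP.orbitPi1 p₀) Set.univ (I : Set (FundamentalGroup P p₀))) :
    Nonempty (SpinorStructure n k d ρ πP) := by
  have := hρ.simplyConnected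
  have := hP.pathConnectedSpace
  have : LocallyPathConnectedSpace G' :=
    ChartedSpace.locallyPathConnectedSpace (EuclideanSpace ℝ (Fin k)) G'
  have hKn : K.Normal := hKI.normal
  have hρc := hρ.isCoveringMap
  have hρs : Function.Surjective ρ :=
    MonoidHom.surjective_of_isOpenMap hρc.isLocalHomeomorph.isOpenMap
  obtain ⟨Q, _, u, cov, θ, hsurj, hθ⟩ :=
    exists_isCoveringMap_of_chartedSpace (d := d) p₀ (QuotientGroup.mk' K)
  obtain ⟨s, hsu, hs1, hsmul, hsc⟩ := cov.exists_lift_action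
    (fun p (g : G') => MulOpposite.op (ρ g) • p)
    (hP.continuous_smul.comp
      (continuous_fst.prodMk (hρc.continuous.comp continuous_snd)))
    (fun p => by rw [map_one, MulOpposite.op_one, one_smul])
    (fun p g g' => by rw [map_mul, MulOpposite.op_mul, mul_smul])
  let act : MulAction G'ᵐᵒᵖ Q :=
    { smul := fun g q => s q (MulOpposite.unop g)
      one_smul := hs1
      mul_smul := fun g g' q => (hsmul q _ _).symm }
  have hact : Continuous fun x : Q × G' => MulOpposite.op x.2 • x.1 := hsc
  have heq : ∀ (q : Q) (g : G'), u (MulOpposite.op g • q) = MulOpposite.op (ρ g) • u q := hsu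
  have hmon : ∀ (x : u ⁻¹' {p₀}) (a : FundamentalGroup G 1),
      (cov.monodromy (hP.orbitPi1 p₀ a).toPath x : Q) =
        MulOpposite.op (hρc.monodromy a.toPath ⟨1, map_one ρ⟩ : G') • (x : Q) := fun x =>
    hP.monodromy_orbitPi1 hρc (fun q => hact.comp (Continuous.prodMk_right q)) cov heq x
  have hker : ∀ {g : G'}, ρ g = 1 → ∀ q : Q, u (MulOpposite.op g • q) = u q := by
    intro g hg q
    rw [heq, hg, MulOpposite.op_one, one_smul]
  have hdeck : ∀ {g : G'} (hg : ρ g = 1) {p : P} (γ : Path.Homotopic.Quotient p p₀)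
      (x : u ⁻¹' {p}), (cov.monodromy γ ⟨MulOpposite.op g • (x : Q), (hker hg x).trans x.2⟩ : Q) =
        MulOpposite.op g • (cov.monodromy γ x : Q) := fun {g} hg {p} γ x =>
    cov.monodromy_comp_deck ⟨fun q => MulOpposite.op g • q,
      hact.comp (f := fun q => (q, g)) (by fun_prop)⟩ (hker hg) γ x
  -- Writing `g` as the endpoint of the lift of `a`, a fixed point forces `i_* a` into `K ⊓ I`, so
  -- `a = 1` by injectivity of `i_*`.
  have hfree₀ : ∀ (x : u ⁻¹' {p₀}) (g : G'), ρ g = 1 → MulOpposite.op g • (x : Q) = x →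
      g = 1 := by
    intro x g hg hx
    obtain ⟨a, rfl⟩ := exists_monodromy_eq hρc hg
    have h1 : cov.monodromy (hP.orbitPi1 p₀ a).toPath x = x := Subtype.ext ((hmon x a).trans hx)
    have h2 := hθ (hP.orbitPi1 p₀ a) x
    rw [h1] at h2
    have h3 : hP.orbitPi1 p₀ a ∈ K ⊓ I :=
      ⟨(QuotientGroup.eq_one_iff _).1 (right_eq_mul.1 h2), hI.mapsTo (mem_univ a)⟩
    rw [hKI.inf_eq_bot, Subgroup.mem_bot] at h3
    have h4 : a = 1 := hI.injOn (mem_univ _) (mem_univ _) (h3.trans (map_one _).symm)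
    subst h4
    exact congr_arg Subtype.val (congrFun hρc.monodromy_refl ⟨1, map_one ρ⟩)
  have hfree : ∀ (q : Q) (g : G'), MulOpposite.op g • q = q → g = 1 := by
    intro q g hg
    have hρg : ρ g = 1 := hP.free (u q) _ (by rw [← heq, hg])
    -- Monodromy along `γ` commutes with the action of `ker ρ`, which reduces the claim to the fibre
    -- over `p₀`.
    let γ : Path.Homotopic.Quotient (u q) p₀ := .mk (PathConnectedSpace.somePath (u q) p₀)
    refine hfree₀ (cov.monodromy γ ⟨q, rfl⟩) g hρg ?_
    rw [← hdeck hρg γ ⟨q, rfl⟩]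
    congr 3
  have htrans₀ : ∀ x y : u ⁻¹' {p₀}, ∃ g : G', ρ g = 1 ∧ MulOpposite.op g • (x : Q) = y := by
    intro x y
    obtain ⟨a, ha⟩ := QuotientGroup.mk'_surjective K (θ y * (θ x)⁻¹)
    have ha' : a ∈ K ⊔ I := hKI.sup_eq_top ▸ Subgroup.mem_top a
    -- The factor in `K` acts trivially on the fibre, so the factor in `I`, realised by `ker ρ`,
    -- already moves `x` to `y`.
    obtain ⟨κ, hκ, ι, hι, rfl⟩ := Subgroup.mem_sup_of_normal_left.1 ha'
    obtain ⟨b, -, rfl⟩ := hI.surjOn hι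
    refine ⟨_, (hρc.monodromy b.toPath ⟨1, map_one ρ⟩).2, ?_⟩
    rw [← hmon]
    refine congr_arg Subtype.val (θ.injective ?_)
    rw [hθ, ← one_mul (QuotientGroup.mk' K (hP.orbitPi1 p₀ b)),
      ← (QuotientGroup.eq_one_iff κ).2 hκ]
    change QuotientGroup.mk' K κ * _ * _ = _
    rw [← map_mul, ha, inv_mul_cancel_right]
  have htrans : ∀ q q' : Q, πP (u q) = πP (u q') → ∃ g : G', MulOpposite.op g • q = q' := by
    intro q q' hqq
    obtain ⟨g, hg⟩ := hP.transitive _ _ hqq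
    obtain ⟨g, rfl⟩ := hρs g
    rw [← heq] at hg
    set q₁ := MulOpposite.op g • q with hq₁
    let γ : Path.Homotopic.Quotient (u q₁) p₀ := .mk (PathConnectedSpace.somePath (u q₁) p₀)
    obtain ⟨g₀, hg₀, hgg⟩ := htrans₀ (cov.monodromy γ ⟨q₁, rfl⟩) (cov.monodromy γ ⟨q', hg.symm⟩)
    rw [← hdeck hg₀ γ ⟨q₁, rfl⟩] at hgg
    have h1 := congr_arg Subtype.val ((cov.monodromy_bijective γ).1 (Subtype.ext hgg))
    refine ⟨g * g₀, ?_⟩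
    rw [MulOpposite.op_mul, mul_smul]
    exact h1
  have hu := cov.isLocalHomeomorph
  let := hu.pullbackChartedSpace (d := d)
  have hbundle : IsPrincipalBundle n k d G' (πP ∘ u) :=
    hP.isPrincipalBundle_cover hu hsurj hρ.isLocalDiffeomorph hact heq hfree htrans
  have hT2 : T2Space Q := ⟨fun x y hxy => by
    by_cases h : u x = u y
    · exact cov.isSeparatedMap x y h hxy
    · obtain ⟨V, W, hV, hW, hxV, hyW, hVW⟩ := t2_separation h
      exact ⟨u ⁻¹' V, u ⁻¹' W, hV.preimage cov.continuous, hW.preimage cov.continuous, hxV, hyW,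
        hVW.preimage u⟩⟩
  -- Paracompactness of `Q` is obtained through second countability: `M` and `G'` are connected and
  -- paracompact, hence σ-compact and second countable, and so `Q` is second countable as a bundle
  -- over `M` with fibre `G'`.
  have : LocallyCompactSpace M := ChartedSpace.locallyCompactSpace (EuclideanSpace ℝ (Fin n)) M
  have : LocallyCompactSpace G' := ChartedSpace.locallyCompactSpace (EuclideanSpace ℝ (Fin k)) G'
  have : LocallyCompactSpace Q := ChartedSpace.locallyCompactSpace (EuclideanSpace ℝ (Fin d)) Q
  have := sigmaCompactSpace_of_paracompact_connected M
  have := sigmaCompactSpace_of_paracompact_connected G'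
  have : SecondCountableTopology M :=
    ChartedSpace.secondCountable_of_sigmaCompact (EuclideanSpace ℝ (Fin n)) M
  have : SecondCountableTopology G' :=
    ChartedSpace.secondCountable_of_sigmaCompact (EuclideanSpace ℝ (Fin k)) G'
  have : SecondCountableTopology Q := hbundle.secondCountableTopology
  exact ⟨
    { Q := Q
      dim := d
      isManifold := hu.isManifold_pullback
      πQ := πP ∘ u
      isPrincipalBundle := hbundle
      u := u
      smooth_u := hu.contMDiff_pullback
      proj_u := fun q => rfl
      equivariant_u := heq }⟩

end SplittingToSpinor

theorem mainTheorem1 (n k d : ℕ)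
    {M : Type uM} [TopologicalSpace M] [ChartedSpace (EuclideanSpace ℝ (Fin n)) M]
    [IsManifold (𝓡 n) ∞ M] [T2Space M] [ParacompactSpace M] [ConnectedSpace M]
    {G : Type uG} [Group G] [TopologicalSpace G] [ChartedSpace (EuclideanSpace ℝ (Fin k)) G]
    [LieGroup (𝓡 k) ∞ G] [T2Space G] [ParacompactSpace G] [ConnectedSpace G]
    (hG : ¬ SimplyConnectedSpace G)
    {G' : Type uGt} [Group G'] [TopologicalSpace G'] [ChartedSpace (EuclideanSpace ℝ (Fin k)) G']
    [LieGroup (𝓡 k) ∞ G'] [T2Space G'] [ParacompactSpace G']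
    (ρ : G' →* G) (hρ : IsUniversalCoveringGroup k ρ)
    {P : Type uP} [TopologicalSpace P] [ChartedSpace (EuclideanSpace ℝ (Fin d)) P]
    [IsManifold (𝓡 d) ∞ P] [T2Space P] [ParacompactSpace P] [MulAction Gᵐᵒᵖ P]
    (πP : P → M) (hP : IsPrincipalBundle n k d G πP) (p₀ : P) :
    Nonempty (SpinorStructure n k d ρ πP) ↔
      ∃ K I : Subgroup (FundamentalGroup P p₀),
        IsInternalDirectProduct K I ∧
        Set.BijOn (hP.projPi1 p₀) (K : Set (FundamentalGroup P p₀)) Set.univ ∧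
        Set.BijOn (hP.orbitPi1 p₀) Set.univ (I : Set (FundamentalGroup P p₀)) := by
  have : IsTopologicalGroup G := topologicalGroup_of_lieGroup (𝓡 k) ∞
  have : IsTopologicalGroup G' := topologicalGroup_of_lieGroup (𝓡 k) ∞
  constructor
  · rintro ⟨S⟩
    exact S.exists_splitting hρ hP p₀
  · rintro ⟨K, I, hKI, -, hI⟩
    exact hP.nonempty_spinorStructure hρ p₀ hKI hI
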